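/- Let $\beta$ be an indeterminate and put $x\oplus y=x+y+\beta xy$, $x\ominus y=\dfrac{x-y}{1+\beta y}$, $\ominus t=0\ominus t=-\dfrac{t}{1+\beta t}$. For an integer $n\ge 0$ let $\mathcal{SP}_n$ be the set of strict partitions $\lambda=(\lambda_1>\cdots>\lambda_r>0)$ of length $r\le n$, and let $\mathcal{SP}=\bigcup_n\mathcal{SP}_n$. For $\lambda\in\mathcal{SP}_n$ of length $r$ put $$GP_\lambda(x_1,\dots,x_n)=\frac{1}{(n-r)!}\sum_{w\in S_n}w\Big[\prod_{i=1}^r x_i^{\lambda_i}\prod_{i=1}^r\prod_{j=i+1}^n\frac{x_i\oplus x_j}{x_i\ominus x_j}\Big],$$ where $w\in S_n$ permutes the variables. Let $G\Gamma_n$ be the ring of symmetric polynomials $f\in\mathbb{Z}[\beta][x_1,\dots,x_n]$ such that for all $1\le i<j\le n$ the rational function $f(x_1,\dots,x_{i-1},t,x_{i+1},\dots,x_{j-1},\ominus t,x_{j+1},\dots,x_n)$ does not depend on $t$. Let $G\Gamma=\varprojlim G\Gamma_n$ with respect to the specializations $x_{n+1}=0$. (1) For every $n\ge 0$, the functions $GP_\lambda(x_1,\dots,x_n)$,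 $\lambda\in\mathcal{SP}_n$, are polynomials lying in $G\Gamma_n$ and form a $\mathbb{Z}[\beta]$-basis of $G\Gamma_n$. (2) For every $\lambda\in\mathcal{SP}$ of length $r$ there is an element $GP_\lambda(x)\in G\Gamma$ whose component in $G\Gamma_n$ is $GP_\lambda(x_1,\dots,x_n)$ if $r\le n$ and $0$ if $r>n$. Every $f\in G\Gamma$ can be written uniquely as a possibly infinite combination $$f=\sum_{\lambda\in\mathcal{SP}}c_\lambda\,GP_\lambda(x),\qquad c_\lambda\in\mathbb{Z}[\beta],$$ such that for every $n$ the set $\{\lambda\in\mathcal{SP}_n : c_\lambda\ne 0\}$ is finite; the infinite sum is understood componentwise, i.e. for every $n$ the component of $f$ in $G\Gamma_n$ is the finite sum $\sum_{\lambda\in\mathcal{SP}_n}c_\lambda\,GP_\lambda(x_1,\dots,x_n)$. -/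

import Mathlib

/-- A strict partition: a strictly decreasing finite list of positive integers. -/
structure StrictPartition where
  parts : List ℕ
  strictlyDecreasing : parts.Pairwise (fun a b => b < a)
  pos : ∀ a ∈ parts, 0 < a

/-- The length (number of parts) of a strict partition. -/
def StrictPartition.length (lam : StrictPartition) : ℕ := lam.parts.length

/-- `SP n` is the set of strict partitions of length at most `n`. -/
abbrev SP (n : ℕ) : Type := {lam : StrictPartition // lam.length ≤ n}

/-- The coefficient ring `ℤ[β]`; the polynomial variable is `β`. -/
abbrev ZBeta : Type := Polynomial ℤ

noncomputable section

/-- `x ⊕ y = x + y + β x y`. -/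
def oplus {K : Type*} [Field K] (β x y : K) : K := x + y + β * x * y

/-- `x ⊖ y = (x - y) / (1 + β y)`; `⊖ y` is `0 ⊖ y`. -/
def ominus {K : Type*} [Field K] (β x y : K) : K := (x - y) / (1 + β * y)

/-- `[x|b]^k = (x ⊕ b₁) ⋯ (x ⊕ b_k)`; here `b i` stands for `b_{i+1}`. -/
def deformedPow {K : Type*} [Field K] (β : K) (b : ℕ → K) (x : K) (k : ℕ) : K :=
  ∏ i ∈ Finset.range k, oplus β x (b i)

/-- The Hall-Littlewood type expression, for `r = length of lam ≤ n`,
`1/(n-r)! * ∑_{w ∈ S_n} w [ ∏_{i ≤ r} [x_i|b]^{lam_i} * ∏_{i ≤ r} ∏_{i < j ≤ n}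
  (x_i ⊕ x_j) / (x_i ⊖ x_j) ]`, evaluated in a field. Indices are shifted to start at `0`. -/
def factorialGP {K : Type*} [Field K] (β : K) {n : ℕ} (x : Fin n → K) (b : ℕ → K)
    (lam : StrictPartition) : K :=
  (((n - lam.length).factorial : ℕ) : K)⁻¹ *
    ∑ w : Equiv.Perm (Fin n),
      ∏ i ∈ Finset.univ.filter (fun i : Fin n => (i : ℕ) < lam.length),
        (deformedPow β b (x (w i)) (lam.parts.getD i 0) *
          ∏ j ∈ Finset.Ioi i, oplus β (x (w i)) (x (w j)) / ominus β (x (w i)) (x (w j)))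

/-- The field of fractions of `ℤ[β][x_1, …, x_n]`. -/
abbrev RatField (n : ℕ) : Type := FractionRing (MvPolynomial (Fin n) ZBeta)

/-- The `K`-theoretic `P`-function `GP_lam(x_1, …, x_n)` (all `b_i = 0`), as an element of the
field of fractions of `ℤ[β][x_1, …, x_n]`. -/
def GP (n : ℕ) (lam : StrictPartition) : RatField n :=
  factorialGP (algebraMap ZBeta (RatField n) Polynomial.X)
    (fun i => algebraMap (MvPolynomial (Fin n) ZBeta) (RatField n) (MvPolynomial.X i))
    (fun _ => 0) lam

/-- The substitution `x_i ↦ t`, `x_j ↦ ⊖ t`, `x_k ↦ x_k` for `k ≠ i, j`, with values in the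
rational functions in the variable `t` over the field of fractions of `ℤ[β][x_1, …, x_n]`. -/
def substCancel (n : ℕ) (i j : Fin n) :
    MvPolynomial (Fin n) ZBeta →ₐ[ZBeta] RatFunc (RatField n) :=
  MvPolynomial.aeval
    (Function.update
      (Function.update
        (fun k => RatFunc.C
          (algebraMap (MvPolynomial (Fin n) ZBeta) (RatField n) (MvPolynomial.X k)))
        i RatFunc.X)
      j (ominus (algebraMap ZBeta (RatFunc (RatField n)) Polynomial.X) 0 RatFunc.X))

theorem RatFunc_C_algebraMap_ZBeta (n : ℕ) (a : ZBeta) :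
    algebraMap ZBeta (RatFunc (RatField n)) a =
      RatFunc.C (algebraMap ZBeta (RatField n) a) := by
  rw [IsScalarTower.algebraMap_apply ZBeta (RatField n) (RatFunc (RatField n))]
  rfl

/-- `GΓ_n`: the symmetric polynomials `f` over `ℤ[β]` such that, for all `i < j`, the rational
function `f(…, t, …, ⊖ t, …)` does not depend on `t`. -/
def GGamma (n : ℕ) : Subalgebra ZBeta (MvPolynomial (Fin n) ZBeta) where
  carrier := {f | f.IsSymmetric ∧
    ∀ i j : Fin n, i < j → ∃ c : RatField n, substCancel n i j f = RatFunc.C c}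
  mul_mem' := by
    rintro f g ⟨hf, hf'⟩ ⟨hg, hg'⟩
    refine ⟨hf.mul hg, fun i j hij => ?_⟩
    obtain ⟨c, hc⟩ := hf' i j hij
    obtain ⟨d, hd⟩ := hg' i j hij
    exact ⟨c * d, by rw [map_mul, map_mul, hc, hd]⟩
  add_mem' := by
    rintro f g ⟨hf, hf'⟩ ⟨hg, hg'⟩
    refine ⟨hf.add hg, fun i j hij => ?_⟩
    obtain ⟨c, hc⟩ := hf' i j hij
    obtain ⟨d, hd⟩ := hg' i j hij
    exact ⟨c + d, by rw [map_add, map_add, hc, hd]⟩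
  algebraMap_mem' := by
    intro a
    refine ⟨MvPolynomial.IsSymmetric.C a, fun i j _ => ?_⟩
    exact ⟨algebraMap ZBeta (RatField n) a, by
      rw [AlgHom.commutes, RatFunc_C_algebraMap_ZBeta]⟩

/-- The specialization `x_{n+1} = 0`. -/
def specializeLast (n : ℕ) :
    MvPolynomial (Fin (n + 1)) ZBeta →ₐ[ZBeta] MvPolynomial (Fin n) ZBeta :=
  MvPolynomial.aeval (Fin.snoc (α := fun _ => MvPolynomial (Fin n) ZBeta) MvPolynomial.X 0)

/-- `GΓ`: the inverse limit of the rings `GΓ_n` along the specializations `x_{n+1} = 0`, realized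
as the ring of compatible sequences `(f_n)` with `f_n ∈ GΓ_n`. -/
def GGammaLim : Subalgebra ZBeta (∀ n : ℕ, MvPolynomial (Fin n) ZBeta) where
  carrier := {f | (∀ n, f n ∈ GGamma n) ∧ ∀ n, specializeLast n (f (n + 1)) = f n}
  mul_mem' := by
    rintro f g ⟨hf, hf'⟩ ⟨hg, hg'⟩
    exact ⟨fun n => mul_mem (hf n) (hg n), fun n => by
      rw [Pi.mul_apply, Pi.mul_apply, map_mul, hf', hg']⟩
  add_mem' := by
    rintro f g ⟨hf, hf'⟩ ⟨hg, hg'⟩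
    exact ⟨fun n => add_mem (hf n) (hg n), fun n => by
      rw [Pi.add_apply, Pi.add_apply, map_add, hf', hg']⟩
  algebraMap_mem' := by
    intro a
    exact ⟨fun n => (GGamma n).algebraMap_mem a, fun n => (specializeLast n).commutes a⟩

/-- `f = ∑_lam c_lam G_lam` as a possibly infinite sum in `GΓ`: for every `n` only finitely many
`lam` of length at most `n` have `c_lam ≠ 0`, and the components in `n` variables satisfy
`f_n = ∑ c_lam (G_lam)_n`, the sum being over these finitely many `lam` (to be used for families
`G` such that `(G_lam)_n = 0` whenever the length of `lam` exceeds `n`). -/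
def IsInfiniteCombination (G : StrictPartition → GGammaLim) (c : StrictPartition → ZBeta)
    (f : GGammaLim) : Prop :=
  ∃ hfin : ∀ n : ℕ, {lam : StrictPartition | lam.length ≤ n ∧ c lam ≠ 0}.Finite,
    ∀ n : ℕ, f.1 n = ∑ lam ∈ (hfin n).toFinset, c lam • (G lam).1 n

end

/-! Write r for the length of λ. A summand of `GP_λ` depends only on w(1), …, w(r), so the factor
1/(n-r)! disappears and `GP_λ` is a sum over injections of r indices into n. Multiplied by the
Vandermonde product this sum becomes an antisymmetric polynomial over ℤ[β]. The Vandermonde product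
divides every such polynomial, so `GP_λ` is a symmetric polynomial. Setting x_i = t, x_j = ⊖t kills
every summand that selects i or j. In the others the factors containing t and ⊖t cancel in pairs, so
`GP_λ` lies in `GΓ_n`. Setting the last variable to 0 gives `GP_λ` in one variable fewer, which is 0
once r exceeds the number of variables.

The basis property is proved by induction on n along x_{n+1} = 0, so what matters is the kernel of
this specialization. Independence of t is equivalent to x_i ⊕ x_j dividing f - f|_{x_i = x_j = 0}
(`exists_substCancel_eq_C_iff`). An f in the kernel is divisible by every variable, hence by every
x_i ⊕ x_j. These are pairwise non-associated primes, so their product divides f. The quotient times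
the Vandermonde product is antisymmetric and divisible by every variable. Such polynomials are
spanned by the alternants det(x_i^{b_j}(1+βx_i)^j) with b strictly decreasing and positive
(`mem_span_altSum`), and these correspond to the `GP_λ` of full length
(`vandermondeProd_mul_GPPoly_of_length_eq`).

In the limit, the coefficient of λ is the same for every n ≥ r, so the finite expansions glue
uniquely. -/

noncomputable section

open MvPolynomial Finset

/-! ### The Hall-Littlewood sum as a sum over embeddings -/

section FieldSums

variable {K : Type*} [Field K]

lemma oplus_div_ominus (β x y : K) :
    oplus β x y / ominus β x y = oplus β x y * (1 + β * y) / (x - y) := by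
  rw [ominus, div_div_eq_mul_div]

/-- The summand of the Hall-Littlewood sum attached to an ordered choice `e` of `r` variables. -/
def embeddingTerm (β : K) {n : ℕ} (x : Fin n → K) {r : ℕ} (p : List ℕ) (e : Fin r ↪ Fin n) : K :=
  ∏ a : Fin r, (x (e a) ^ p.getD a 0 *
    ∏ k ∈ univ.filter (fun k => ∀ b ≤ a, e b ≠ k),
      oplus β (x (e a)) (x k) / ominus β (x (e a)) (x k))

/-- The Hall-Littlewood sum over ordered choices of `r` variables. -/
def embeddingSum (β : K) {n : ℕ} (x : Fin n → K) (lam : StrictPartition) : K :=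
  ∑ e : Fin lam.length ↪ Fin n, embeddingTerm β x lam.parts e

/-- The summand of the Hall-Littlewood sum attached to a permutation `w`. -/
def permTerm (β : K) {n : ℕ} (x : Fin n → K) (r : ℕ) (p : List ℕ) (w : Equiv.Perm (Fin n)) : K :=
  ∏ i ∈ univ.filter (fun i : Fin n => (i : ℕ) < r),
    (x (w i) ^ p.getD i 0 *
      ∏ j ∈ Ioi i, oplus β (x (w i)) (x (w j)) / ominus β (x (w i)) (x (w j)))

/-- The first `r` values of a permutation. -/
def restrictPerm {r n : ℕ} (h : r ≤ n) (w : Equiv.Perm (Fin n)) : Fin r ↪ Fin n :=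
  (Fin.castLEEmb h).trans w.toEmbedding

lemma restrictPerm_apply {r n : ℕ} (h : r ≤ n) (w : Equiv.Perm (Fin n)) (a : Fin r) :
    restrictPerm h w a = w (Fin.castLE h a) := rfl

/-- The values w(j) with j > i are exactly the indices outside w(0), …, w(i), so only the first r
values of w matter. -/
lemma permTerm_eq_embeddingTerm (β : K) {n : ℕ} (x : Fin n → K) {r : ℕ} (h : r ≤ n) (p : List ℕ)
    (w : Equiv.Perm (Fin n)) :
    permTerm β x r p w = embeddingTerm β x p (restrictPerm h w) := by
  symm
  refine prod_bij (fun a _ => Fin.castLE h a) (fun a _ => by simp)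
    (fun a _ b _ hab => Fin.castLE_injective h hab) (fun i hi => ?_) (fun a _ => ?_)
  · exact ⟨⟨i, (mem_filter.1 hi).2⟩, mem_univ _, rfl⟩
  · rw [restrictPerm_apply]
    congr 1
    symm
    refine prod_bij (fun j _ => w j) (fun j hj => ?_) (fun j _ k _ hjk => w.injective hjk)
      (fun k hk => ?_) (fun j _ => rfl)
    · refine mem_filter.2 ⟨mem_univ _, fun b hb hbj => ?_⟩
      rw [restrictPerm_apply] at hbj
      have h1 := w.injective hbj
      have h2 := mem_Ioi.1 hj
      rw [← h1] at h2
      exact absurd (Fin.le_def.1 hb) (not_le.2 (Fin.lt_def.1 h2))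
    · refine ⟨w.symm k, mem_Ioi.2 ?_, by simp⟩
      by_contra hlt
      have hle : (w.symm k : ℕ) ≤ a := Fin.le_def.1 (not_lt.1 hlt)
      refine (mem_filter.1 hk).2 ⟨w.symm k, hle.trans_lt a.2⟩ (Fin.le_def.2 hle) ?_
      rw [restrictPerm_apply]
      exact w.apply_symm_apply k

lemma exists_restrictPerm_eq {r n : ℕ} (h : r ≤ n) (e : Fin r ↪ Fin n) :
    ∃ w, restrictPerm h w = e := by
  obtain ⟨σ, hσ⟩ := Equiv.Perm.exists_extending_pair (Fin.castLE h) e (Fin.castLE_injective h)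
    e.injective
  exact ⟨σ, DFunLike.ext _ _ fun a => by rw [restrictPerm_apply]; exact hσ a⟩

/-- Left multiplication permutes the fibres transitively, so all have the same size, n! divided by
the number of embeddings. -/
lemma card_restrictPerm_fiber {r n : ℕ} (h : r ≤ n) (e : Fin r ↪ Fin n) :
    #{w | restrictPerm h w = e} = (n - r).factorial := by
  have key : ∀ e', #{w | restrictPerm h w = e'} = #{w | restrictPerm h w = e} := by
    intro e'
    obtain ⟨u, rfl⟩ := exists_restrictPerm_eq h e
    obtain ⟨v, rfl⟩ := exists_restrictPerm_eq h e'
    refine card_bij (fun w _ => u * v⁻¹ * w) (fun w hw => ?_)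
      (fun w _ w' _ hww => mul_left_cancel hww) (fun w hw => ?_)
    · have hw := (mem_filter.1 hw).2
      refine mem_filter.2 ⟨mem_univ _, DFunLike.ext _ _ fun a => ?_⟩
      have := DFunLike.congr_fun hw a
      simp only [restrictPerm_apply, Equiv.Perm.mul_apply] at this ⊢
      rw [this]; simp
    · have hw := (mem_filter.1 hw).2
      refine ⟨v * u⁻¹ * w, mem_filter.2 ⟨mem_univ _, DFunLike.ext _ _ fun a => ?_⟩, by group⟩
      have := DFunLike.congr_fun hw a
      simp only [restrictPerm_apply, Equiv.Perm.mul_apply] at this ⊢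
      rw [this]; simp
  have hsum : ∑ e' : Fin r ↪ Fin n, #{w | restrictPerm h w = e'} = n.factorial := by
    have := card_eq_sum_card_fiberwise (s := (univ : Finset (Equiv.Perm (Fin n))))
      (f := restrictPerm h) (t := univ) (fun _ _ => mem_univ _)
    rw [← this, card_univ, Fintype.card_perm, Fintype.card_fin]
  rw [sum_congr rfl (fun e' _ => key e'), sum_const, card_univ, Fintype.card_embedding_eq,
    Fintype.card_fin, Fintype.card_fin, ← Nat.factorial_mul_descFactorial h, smul_eq_mul,
    mul_comm] at hsum
  exact Nat.eq_of_mul_eq_mul_right (Nat.descFactorial_pos.2 h) hsum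

lemma factorialGP_eq_embeddingSum [CharZero K] (β : K) {n : ℕ} (x : Fin n → K)
    (lam : StrictPartition) (h : lam.length ≤ n) :
    factorialGP β x (fun _ => 0) lam = embeddingSum β x lam := by
  have h1 : ∀ w : Equiv.Perm (Fin n),
      ∏ i ∈ univ.filter (fun i : Fin n => (i : ℕ) < lam.length),
        (deformedPow β (fun _ => 0) (x (w i)) (lam.parts.getD i 0) *
          ∏ j ∈ Ioi i, oplus β (x (w i)) (x (w j)) / ominus β (x (w i)) (x (w j))) =
      embeddingTerm β x lam.parts (restrictPerm h w) := by
    intro w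
    rw [← permTerm_eq_embeddingTerm]
    refine prod_congr rfl fun i _ => ?_
    simp [deformedPow, oplus]
  rw [factorialGP, sum_congr rfl (fun w _ => h1 w), embeddingSum,
    ← sum_fiberwise univ (restrictPerm h) (fun w => embeddingTerm β x lam.parts (restrictPerm h w))]
  have h2 : ∀ e : Fin lam.length ↪ Fin n, ∑ w with restrictPerm h w = e,
      embeddingTerm β x lam.parts (restrictPerm h w) =
      ((n - lam.length).factorial : K) * embeddingTerm β x lam.parts e := by
    intro e
    rw [sum_congr rfl (fun w hw => by rw [(mem_filter.1 hw).2]), sum_const,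
      card_restrictPerm_fiber, nsmul_eq_mul]
  rw [sum_congr rfl (fun e _ => h2 e), ← mul_sum, inv_mul_cancel_left₀]
  exact Nat.cast_ne_zero.2 (Nat.factorial_ne_zero _)

lemma embeddingSum_comp_perm (β : K) {n : ℕ} (x : Fin n → K) (lam : StrictPartition)
    (σ : Equiv.Perm (Fin n)) :
    embeddingSum β (x ∘ σ) lam = embeddingSum β x lam := by
  refine Fintype.sum_equiv (Equiv.embeddingCongr (Equiv.refl _) σ) _ _ fun e => ?_
  refine prod_congr rfl fun a _ => ?_
  have he : ∀ b, Equiv.embeddingCongr (Equiv.refl _) σ e b = σ (e b) := fun b => by simp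
  rw [he]
  congr 1
  refine prod_bij (fun k _ => σ k) (fun k hk => ?_) (fun _ _ _ _ h => σ.injective h)
    (fun k hk => ?_) (fun _ _ => rfl)
  · refine mem_filter.2 ⟨mem_univ _, fun b hb hbk => ?_⟩
    rw [he] at hbk
    exact (mem_filter.1 hk).2 b hb (σ.injective hbk)
  · refine ⟨σ.symm k, mem_filter.2 ⟨mem_univ _, fun b hb hbk => ?_⟩, by simp⟩
    refine (mem_filter.1 hk).2 b hb ?_
    rw [he, hbk, Equiv.apply_symm_apply]

lemma embeddingSum_eq_zero_of_lt (β : K) {n : ℕ} (x : Fin n → K) (lam : StrictPartition)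
    (h : n < lam.length) : embeddingSum β x lam = 0 := by
  have : IsEmpty (Fin lam.length ↪ Fin n) :=
    ⟨fun e => not_le.2 h (by simpa using Fintype.card_le_of_embedding e)⟩
  exact Fintype.sum_empty _

lemma StrictPartition.getD_pos (lam : StrictPartition) {a : ℕ} (h : a < lam.length) :
    0 < lam.parts.getD a 0 := by
  rw [List.getD_eq_getElem _ _ h]
  exact lam.pos _ (List.getElem_mem h)

/-- Choices that select the zero variable vanish because parts are positive. In the others that
variable contributes (x ⊕ 0)/(x ⊖ 0) = 1. -/
lemma embeddingSum_snoc_zero (β : K) {n : ℕ} (x : Fin n → K) (hx : ∀ i, x i ≠ 0)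
    (lam : StrictPartition) :
    embeddingSum β (Fin.snoc (α := fun _ => K) x 0 : Fin (n + 1) → K) lam =
      embeddingSum β x lam := by
  symm
  refine sum_of_injOn (fun e => e.trans Fin.castSuccEmb) (fun e _ e' _ h => ?_)
    (fun _ _ => mem_coe.2 (mem_univ _)) (fun e _ he => ?_) (fun e _ => ?_)
  · refine DFunLike.ext _ _ fun a => ?_
    exact Fin.castSucc_injective n (DFunLike.congr_fun h a)
  · have hlast : ∃ a, e a = Fin.last n := by
      by_contra hne
      push Not at hne
      refine he ⟨⟨fun a => (e a).castPred (hne a), fun a b hab => ?_⟩, by simp, ?_⟩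
      · exact e.injective (Fin.castPred_inj.1 hab)
      · exact DFunLike.ext _ _ fun a => Fin.castSucc_castPred _ (hne a)
    obtain ⟨a, ha⟩ := hlast
    refine prod_eq_zero (mem_univ a) ?_
    rw [ha, Fin.snoc_last, zero_pow (lam.getD_pos a.2).ne', zero_mul]
  · refine prod_congr rfl fun a _ => ?_
    have he : ∀ b, (e.trans Fin.castSuccEmb) b = (e b).castSucc := fun b => rfl
    rw [he, Fin.snoc_castSucc]
    congr 1
    rw [prod_filter, prod_filter, Fin.prod_univ_castSucc]
    have hl : ∀ b ≤ a, (e.trans Fin.castSuccEmb) b ≠ Fin.last n := fun b _ => by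
      rw [he]; exact (Fin.castSucc_lt_last _).ne
    rw [if_pos hl, Fin.snoc_last]
    have h1 : oplus β (x (e a)) 0 / ominus β (x (e a)) 0 = 1 := by
      simp [oplus, ominus, hx]
    rw [h1, mul_one]
    refine prod_congr rfl fun k _ => ?_
    simp only [he, Fin.snoc_castSucc, ne_eq, Fin.castSucc_inj]

end FieldSums

/-! ### Clearing denominators by the Vandermonde product -/

section Numerator

variable {A : Type*} [CommRing A]

/-- The Vandermonde product `∏_{i < j} (x_i - x_j)`. -/
def vandermondeProd {n : ℕ} (x : Fin n → A) : A := ∏ i, ∏ j ∈ Ioi i, (x i - x j)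

lemma vandermondeProd_comp_perm {n : ℕ} (x : Fin n → A) (σ : Equiv.Perm (Fin n)) :
    vandermondeProd (x ∘ σ) = (Equiv.Perm.sign σ : ℤ) * vandermondeProd x :=
  σ.prod_Ioi_comp_eq_sign_mul_prod (f := fun i j => x i - x j) fun _ _ => by ring

lemma vandermondeProd_ne_zero [IsDomain A] {n : ℕ} {x : Fin n → A} (hx : Function.Injective x) :
    vandermondeProd x ≠ 0 :=
  prod_ne_zero_iff.2 fun _ _ => prod_ne_zero_iff.2 fun _ hj =>
    sub_ne_zero.2 fun h => (mem_Ioi.1 hj).ne (hx h)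

lemma map_vandermondeProd {B F : Type*} [CommRing B] [FunLike F A B] [RingHomClass F A B] (φ : F)
    {n : ℕ} (x : Fin n → A) : φ (vandermondeProd x) = vandermondeProd (fun i => φ (x i)) := by
  simp [vandermondeProd, map_prod]

/-- `permTerm` multiplied by the Vandermonde product. -/
def permNumerator (β : A) {n : ℕ} (x : Fin n → A) (r : ℕ) (p : List ℕ)
    (w : Equiv.Perm (Fin n)) : A :=
  (Equiv.Perm.sign w : ℤ) * ∏ i : Fin n,
    if (i : ℕ) < r then x (w i) ^ p.getD i 0 *
      ∏ j ∈ Ioi i, (x (w i) + x (w j) + β * x (w i) * x (w j)) * (1 + β * x (w j))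
    else ∏ j ∈ Ioi i, (x (w i) - x (w j))

lemma map_permNumerator {B F : Type*} [CommRing B] [FunLike F A B] [RingHomClass F A B] (φ : F)
    (β : A) {n : ℕ} (x : Fin n → A) (r : ℕ) (p : List ℕ) (w : Equiv.Perm (Fin n)) :
    φ (permNumerator β x r p w) = permNumerator (φ β) (fun i => φ (x i)) r p w := by
  simp only [permNumerator, map_mul, map_prod, map_intCast]
  congr 1
  refine prod_congr rfl fun i _ => ?_
  split_ifs <;> simp [map_prod]

/-- Reordering the Vandermonde product by w costs sign(w). Its rows i < r then cancel the
denominators and the remaining rows survive. -/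
lemma permNumerator_eq {K : Type*} [Field K] (β : K) {n : ℕ} {x : Fin n → K}
    (hx : Function.Injective x) (r : ℕ) (p : List ℕ) (w : Equiv.Perm (Fin n)) :
    permNumerator β x r p w = vandermondeProd x * permTerm β x r p w := by
  have hs : ((Equiv.Perm.sign w : ℤ) : K) * (Equiv.Perm.sign w : ℤ) = 1 := by
    rw [← Int.cast_mul, ← Units.val_mul, Int.units_mul_self]; simp
  have h1 : vandermondeProd x = (Equiv.Perm.sign w : ℤ) * vandermondeProd (x ∘ w) := by
    rw [vandermondeProd_comp_perm, ← mul_assoc, hs, one_mul]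
  rw [h1, permNumerator, permTerm, mul_assoc, vandermondeProd, prod_filter, ← prod_mul_distrib]
  congr 1
  refine prod_congr rfl fun i _ => ?_
  split_ifs
  · rw [mul_left_comm, ← prod_mul_distrib]
    congr 1
    refine prod_congr rfl fun j hj => ?_
    have : x (w i) - x (w j) ≠ 0 := sub_ne_zero.2 fun h =>
      (mem_Ioi.1 hj).ne (w.injective (hx h))
    rw [oplus_div_ominus, Function.comp_apply, Function.comp_apply, mul_div_cancel₀ _ this, oplus]
  · simp

end Numerator

/-! ### Polynomials that are linear in one variable -/

section Linear

variable {σ A : Type*} [CommRing A] [DecidableEq σ]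

/-- The substitution `x_i ↦ 0`. -/
def eraseVar (i : σ) : MvPolynomial σ A →ₐ[A] MvPolynomial σ A :=
  aeval (Function.update X i 0)

lemma eraseVar_X_self (i : σ) : eraseVar i (X i : MvPolynomial σ A) = 0 := by
  simp [eraseVar]

lemma eraseVar_X_of_ne {i k : σ} (h : k ≠ i) :
    eraseVar i (X k : MvPolynomial σ A) = X k := by
  simp [eraseVar, h]

/-- Division with remainder by `a x_i + b`. -/
lemma exists_pow_mul_sub_dvd {i : σ} {a b : MvPolynomial σ A} (ha : eraseVar i a = a)
    (hb : eraseVar i b = b) (f : MvPolynomial σ A) :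
    ∃ (N : ℕ) (g : MvPolynomial σ A), eraseVar i g = g ∧ a * X i + b ∣ a ^ N * f - g := by
  induction f using MvPolynomial.induction_on with
  | C c => exact ⟨0, C c, by simp [eraseVar], by simp⟩
  | add f₁ f₂ h₁ h₂ =>
    obtain ⟨N₁, g₁, hg₁, q₁, hq₁⟩ := h₁
    obtain ⟨N₂, g₂, hg₂, q₂, hq₂⟩ := h₂
    refine ⟨N₁ + N₂, a ^ N₂ * g₁ + a ^ N₁ * g₂, by simp [hg₁, hg₂, ha],
      a ^ N₂ * q₁ + a ^ N₁ * q₂, ?_⟩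
    linear_combination a ^ N₂ * hq₁ + a ^ N₁ * hq₂
  | mul_X f k h =>
    obtain ⟨N, g, hg, q, hq⟩ := h
    by_cases hk : k = i
    · subst hk
      -- One more factor a turns the remainder g x_i into a x_i g, which is congruent to -g b.
      refine ⟨N + 1, -(g * b), by simp [hg, hb], a * X k * q + g, ?_⟩
      linear_combination a * X k * hq
    · refine ⟨N, g * X k, by simp [hg, eraseVar_X_of_ne hk], q * X k, ?_⟩
      linear_combination X k * hq

variable {K : Type*} [Field K] [Algebra A K] [Algebra (MvPolynomial σ A) K]
  [IsScalarTower A (MvPolynomial σ A) K]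

/-- The substitution `x_i ↦ v` with values in an extension field. -/
def substVar (i : σ) (v : K) : MvPolynomial σ A →ₐ[A] K :=
  aeval (Function.update (fun k => algebraMap (MvPolynomial σ A) K (X k)) i v)

lemma substVar_of_eraseVar_eq {i : σ} {g : MvPolynomial σ A} (hg : eraseVar i g = g) (v : K) :
    substVar i v g = algebraMap (MvPolynomial σ A) K g := by
  have h : (substVar i v).comp (eraseVar i) =
      (IsScalarTower.toAlgHom A (MvPolynomial σ A) K).comp (eraseVar i) := by
    refine MvPolynomial.algHom_ext fun k => ?_
    by_cases hk : k = i
    · subst hk; simp [eraseVar_X_self]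
    · simp [eraseVar_X_of_ne hk, substVar, hk]
  have := DFunLike.congr_fun h g
  simpa [hg] using this

variable [FaithfulSMul (MvPolynomial σ A) K]

/-- Pseudo-division leaves a remainder free of x_i. Substituting the root forces it to be 0, and
coprimality removes the power of a. -/
lemma linear_dvd_iff {i : σ} {a b : MvPolynomial σ A} (ha : eraseVar i a = a)
    (hb : eraseVar i b = b) (hco : IsCoprime (a * X i + b) a) {v : K}
    (hv : algebraMap _ K a * v + algebraMap _ K b = 0) (f : MvPolynomial σ A) :
    a * X i + b ∣ f ↔ substVar i v f = 0 := by
  have hp : substVar i v (a * X i + b) = 0 := by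
    rw [map_add, map_mul, substVar_of_eraseVar_eq ha, substVar_of_eraseVar_eq hb, ← hv]
    simp [substVar]
  constructor
  · rintro ⟨q, rfl⟩
    rw [map_mul, hp, zero_mul]
  · intro h
    obtain ⟨N, g, hg, hd⟩ := exists_pow_mul_sub_dvd ha hb f
    have hg0 : g = 0 := by
      obtain ⟨q, hq⟩ := hd
      have h1 := congrArg (substVar i v) hq
      rw [map_mul, hp, zero_mul, map_sub, map_mul, h, mul_zero, zero_sub, neg_eq_zero,
        substVar_of_eraseVar_eq hg] at h1
      exact (map_eq_zero_iff _ (FaithfulSMul.algebraMap_injective _ K)).1 h1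
    rw [hg0, sub_zero] at hd
    exact hco.pow_right.dvd_of_dvd_mul_left hd

/-- The multiples of a x_i + b form the kernel of a homomorphism to a field. -/
lemma prime_linear {i : σ} {a b : MvPolynomial σ A} (ha : eraseVar i a = a)
    (hb : eraseVar i b = b) (hco : IsCoprime (a * X i + b) a) {v : K}
    (hv : algebraMap _ K a * v + algebraMap _ K b = 0) (hne : a * X i + b ≠ 0) :
    Prime (a * X i + b) := by
  refine ⟨hne, fun hu => ?_, fun f g hfg => ?_⟩
  · have := (linear_dvd_iff ha hb hco hv 1).1 hu.dvd
    simp at this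
  · rw [linear_dvd_iff ha hb hco hv] at hfg ⊢
    rw [linear_dvd_iff ha hb hco hv, ← mul_eq_zero, ← map_mul, hfg]

end Linear

/-! ### The primes x_i ⊕ x_j and x_i - x_j -/

section Factors

variable {n : ℕ}

/-- `β` as a polynomial in `n` variables. -/
def betaPoly (n : ℕ) : MvPolynomial (Fin n) ZBeta := C Polynomial.X

/-- `x_i ⊕ x_j` as a polynomial. -/
def oplusPoly (i j : Fin n) : MvPolynomial (Fin n) ZBeta :=
  X i + X j + betaPoly n * X i * X j

lemma oplusPoly_comm (i j : Fin n) : oplusPoly i j = oplusPoly j i := by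
  rw [oplusPoly, oplusPoly]; ring

lemma oplusPoly_eq_linear (i j : Fin n) :
    oplusPoly i j = (1 + betaPoly n * X i) * X j + X i := by
  rw [oplusPoly]; ring

lemma eraseVar_betaPoly (i : Fin n) : eraseVar i (betaPoly n) = betaPoly n := by
  simp [eraseVar, betaPoly]

lemma eraseVar_one_add_betaPoly {i j : Fin n} (h : i ≠ j) :
    eraseVar j (1 + betaPoly n * X i) = 1 + betaPoly n * X i := by
  simp [eraseVar_betaPoly, eraseVar_X_of_ne h]

/-- This is the identity (1 + βx_i)(1 + βx_j) = 1 + β(x_i ⊕ x_j). -/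
lemma isCoprime_oplusPoly (i j : Fin n) :
    IsCoprime ((1 + betaPoly n * X i) * X j + X i) (1 + betaPoly n * X i) :=
  ⟨-betaPoly n, 1 + betaPoly n * X j, by ring⟩

/-- Specialization of polynomials at `β = 0` and an integral point. -/
def evalZero (y : Fin n → ℤ) : MvPolynomial (Fin n) ZBeta →+* ℤ :=
  eval₂Hom (Polynomial.evalRingHom 0) y

lemma evalZero_X (y : Fin n → ℤ) (i : Fin n) : evalZero y (X i) = y i := by simp [evalZero]

lemma evalZero_oplusPoly (y : Fin n → ℤ) (i j : Fin n) :
    evalZero y (oplusPoly i j) = y i + y j := by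
  simp [evalZero, oplusPoly, betaPoly]

lemma one_add_betaPoly_ne_zero (i : Fin n) : 1 + betaPoly n * X i ≠ 0 := fun h => by
  have := congrArg (evalZero 0) h
  simp [evalZero] at this

lemma ominus_root (i : Fin n) :
    algebraMap (MvPolynomial (Fin n) ZBeta) (RatField n) (1 + betaPoly n * X i) *
      (-algebraMap (MvPolynomial (Fin n) ZBeta) (RatField n) (X i) /
        algebraMap (MvPolynomial (Fin n) ZBeta) (RatField n) (1 + betaPoly n * X i)) +
      algebraMap (MvPolynomial (Fin n) ZBeta) (RatField n) (X i) = 0 := by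
  rw [mul_div_cancel₀, neg_add_cancel]
  exact (map_ne_zero_iff _ (FaithfulSMul.algebraMap_injective _ _)).2 (one_add_betaPoly_ne_zero i)

lemma prime_oplusPoly {i j : Fin n} (h : i ≠ j) : Prime (oplusPoly i j) := by
  have hne : oplusPoly i j ≠ 0 := fun h0 => by
    have := congrArg (evalZero fun _ => 1) h0
    rw [evalZero_oplusPoly] at this
    simp at this
  rw [oplusPoly_eq_linear] at hne ⊢
  exact prime_linear (eraseVar_one_add_betaPoly h) (eraseVar_X_of_ne h) (isCoprime_oplusPoly i j)
    (ominus_root i) hne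

lemma X_sub_X_eq_linear (i j : Fin n) :
    (X i - X j : MvPolynomial (Fin n) ZBeta) = 1 * X i + -X j := by ring

lemma prime_X_sub_X {i j : Fin n} (h : i ≠ j) :
    Prime (X i - X j : MvPolynomial (Fin n) ZBeta) := by
  have hne : (X i - X j : MvPolynomial (Fin n) ZBeta) ≠ 0 :=
    sub_ne_zero.2 fun h0 => h (X_injective h0)
  rw [X_sub_X_eq_linear] at hne ⊢
  exact prime_linear (K := RatField n) (map_one _) (by rw [map_neg, eraseVar_X_of_ne h.symm])
    isCoprime_one_right (v := algebraMap (MvPolynomial (Fin n) ZBeta) _ (X j)) (by simp) hne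

lemma X_sub_X_dvd_iff {i j : Fin n} (h : i ≠ j) (f : MvPolynomial (Fin n) ZBeta) :
    X i - X j ∣ f ↔
      substVar i (algebraMap _ (RatField n) (X j : MvPolynomial (Fin n) ZBeta)) f = 0 := by
  rw [X_sub_X_eq_linear]
  exact linear_dvd_iff (K := RatField n) (map_one _)
    (by rw [map_neg, eraseVar_X_of_ne h.symm])
    isCoprime_one_right (by simp) f

lemma isRelPrime_of_map_ne_zero {R S : Type*} [CommRing R] [IsDomain R] [CommRing S] {p q : R}
    (hp : Prime p) (φ : R →+* S) (h0 : φ p = 0) (h1 : φ q ≠ 0) : IsRelPrime p q := by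
  rw [hp.irreducible.isRelPrime_iff_not_dvd]
  rintro ⟨c, rfl⟩
  exact h1 (by rw [map_mul, h0, zero_mul])

lemma prod_pairs_dvd {f : MvPolynomial (Fin n) ZBeta}
    {p : Fin n → Fin n → MvPolynomial (Fin n) ZBeta}
    (hrel : ∀ i j k l, i < j → k < l → ¬ (i = k ∧ j = l) → IsRelPrime (p i j) (p k l))
    (hdvd : ∀ i j, i < j → p i j ∣ f) : ∏ i, ∏ j ∈ Ioi i, p i j ∣ f := by
  rw [prod_sigma']
  refine prod_dvd_of_isRelPrime (fun x hx y hy hxy => ?_) fun x hx => ?_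
  · refine hrel _ _ _ _ (by simpa using hx) (by simpa using hy) fun h => hxy ?_
    exact Sigma.ext h.1 (heq_of_eq h.2)
  · exact hdvd _ _ (by simpa using hx)

lemma vandermondeProd_X_dvd {f : MvPolynomial (Fin n) ZBeta}
    (h : ∀ i j, i < j → X i - X j ∣ f) :
    vandermondeProd (X : Fin n → MvPolynomial (Fin n) ZBeta) ∣ f := by
  refine prod_pairs_dvd (fun i j k l hij hkl hne => ?_) h
  refine isRelPrime_of_map_ne_zero (prime_X_sub_X hij.ne)
    -- Only the coordinates i and j agree at this point.
    (evalZero fun m => if m = i ∨ m = j then -1 else m) ?_ ?_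
  · simp [evalZero_X]
  · rw [map_sub, evalZero_X, evalZero_X]
    split_ifs with h1 h2 h2
    · rcases h1 with rfl | rfl <;> rcases h2 with rfl | rfl <;> grind
    · omega
    · omega
    · have := Fin.val_ne_of_ne hkl.ne
      omega

/-- The product of all `x_i ⊕ x_j`. -/
def oplusProd (n : ℕ) : MvPolynomial (Fin n) ZBeta := ∏ i, ∏ j ∈ Ioi i, oplusPoly i j

lemma oplusProd_dvd {f : MvPolynomial (Fin n) ZBeta} (h : ∀ i j, i < j → oplusPoly i j ∣ f) :
    oplusProd n ∣ f := by
  refine prod_pairs_dvd (fun i j k l hij hkl hne => ?_) h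
  refine isRelPrime_of_map_ne_zero (prime_oplusPoly hij.ne)
    -- Only the coordinates i and j sum to 0 at this point.
    (evalZero fun m => if m = i then 1 else if m = j then -1 else 5) ?_ ?_
  · simp [evalZero_oplusPoly, hij.ne']
  · rw [evalZero_oplusPoly]
    split_ifs <;> grind

lemma oplusProd_ne_zero (n : ℕ) : oplusProd n ≠ 0 :=
  prod_ne_zero_iff.2 fun _ _ => prod_ne_zero_iff.2 fun _ hj =>
    (prime_oplusPoly (mem_Ioi.1 hj).ne).ne_zero

lemma not_X_dvd_oplusProd (i : Fin n) : ¬ (X i ∣ oplusProd n) := by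
  rintro ⟨c, hc⟩
  have h := congrArg (evalZero fun m => if m = i then 0 else 1) hc
  rw [map_mul, evalZero_X, if_pos rfl, zero_mul, oplusProd, map_prod, prod_eq_zero_iff] at h
  obtain ⟨k, _, hk⟩ := h
  rw [map_prod, prod_eq_zero_iff] at hk
  obtain ⟨l, hl, hkl⟩ := hk
  rw [evalZero_oplusPoly] at hkl
  have := (mem_Ioi.1 hl).ne
  split_ifs at hkl <;> grind

end Factors

/-! ### The polynomials `GP_lam` -/

section GPPoly

variable {n : ℕ}

/-- The antisymmetric numerator of `GP_lam`. -/
def numeratorPoly (n : ℕ) (lam : StrictPartition) : MvPolynomial (Fin n) ZBeta :=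
  if h : lam.length ≤ n then
    ∑ e : Fin lam.length ↪ Fin n,
      permNumerator (betaPoly n) X lam.length lam.parts (exists_restrictPerm_eq h e).choose
  else 0

/-- The field element `β`. -/
abbrev betaIn (K : Type*) [Field K] [Algebra ZBeta K] : K := algebraMap ZBeta K Polynomial.X

lemma aeval_betaPoly {B : Type*} [CommRing B] [Algebra ZBeta B] (x : Fin n → B) :
    aeval x (betaPoly n) = algebraMap ZBeta B Polynomial.X := by
  simp [betaPoly]

/-- The permutation chosen to extend each embedding is immaterial. Taking one per embedding avoids
division by (n-r)! in ℤ[β]. -/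
lemma aeval_numeratorPoly {K : Type*} [Field K] [Algebra ZBeta K] {x : Fin n → K}
    (hx : Function.Injective x) (lam : StrictPartition) :
    aeval x (numeratorPoly n lam) = vandermondeProd x * embeddingSum (betaIn K) x lam := by
  rw [numeratorPoly]
  split_ifs with h
  · rw [map_sum, embeddingSum, mul_sum]
    refine sum_congr rfl fun e _ => ?_
    rw [map_permNumerator, aeval_betaPoly]
    simp only [aeval_X]
    rw [permNumerator_eq _ hx, permTerm_eq_embeddingTerm _ _ h,
      (exists_restrictPerm_eq h e).choose_spec]
  · rw [map_zero, embeddingSum_eq_zero_of_lt _ _ _ (not_le.1 h), mul_zero]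

/-- The variables as elements of the field of fractions. -/
abbrev ratVar (n : ℕ) (i : Fin n) : RatField n :=
  algebraMap (MvPolynomial (Fin n) ZBeta) (RatField n) (X i)

lemma ratVar_injective : Function.Injective (ratVar n) :=
  (FaithfulSMul.algebraMap_injective _ _).comp X_injective

lemma ratVar_ne_zero (i : Fin n) : ratVar n i ≠ 0 :=
  (map_ne_zero_iff _ (FaithfulSMul.algebraMap_injective _ _)).2 (X_ne_zero i)

lemma aeval_ratVar (f : MvPolynomial (Fin n) ZBeta) :
    aeval (ratVar n) f = algebraMap _ (RatField n) f := by
  have : aeval (ratVar n) =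
      IsScalarTower.toAlgHom ZBeta (MvPolynomial (Fin n) ZBeta) (RatField n) :=
    MvPolynomial.algHom_ext fun i => by simp
  rw [this]; rfl

lemma algebraMap_rename (σ : Equiv.Perm (Fin n)) (f : MvPolynomial (Fin n) ZBeta) :
    algebraMap _ (RatField n) (rename σ f) = aeval (ratVar n ∘ σ) f := by
  rw [← aeval_ratVar, aeval_rename]

lemma rename_vandermondeProd (σ : Equiv.Perm (Fin n)) :
    rename σ (vandermondeProd (X : Fin n → MvPolynomial (Fin n) ZBeta)) =
      ((Equiv.Perm.sign σ : ℤ) : MvPolynomial (Fin n) ZBeta) * vandermondeProd X := by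
  rw [map_vandermondeProd, ← vandermondeProd_comp_perm]
  congr 1
  funext i
  simp

/-- Antisymmetric polynomials. -/
def IsAntisymmetric (f : MvPolynomial (Fin n) ZBeta) : Prop :=
  ∀ σ : Equiv.Perm (Fin n), rename σ f = (Equiv.Perm.sign σ : ℤ) * f

lemma isAntisymmetric_numeratorPoly (lam : StrictPartition) :
    IsAntisymmetric (numeratorPoly n lam) := by
  intro σ
  apply FaithfulSMul.algebraMap_injective (MvPolynomial (Fin n) ZBeta) (RatField n)
  rw [algebraMap_rename, aeval_numeratorPoly (ratVar_injective.comp σ.injective),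
    embeddingSum_comp_perm, vandermondeProd_comp_perm, map_mul, map_intCast, mul_assoc,
    ← aeval_numeratorPoly ratVar_injective, aeval_ratVar]

/-- At x_i = x_j, swapping the two variables changes nothing, yet antisymmetry changes the sign. So
f vanishes there. -/
lemma IsAntisymmetric.vandermondeProd_dvd {f : MvPolynomial (Fin n) ZBeta}
    (hf : IsAntisymmetric f) :
    vandermondeProd (X : Fin n → MvPolynomial (Fin n) ZBeta) ∣ f := by
  refine vandermondeProd_X_dvd fun i j hij => ?_
  rw [X_sub_X_dvd_iff hij.ne]
  set φ : MvPolynomial (Fin n) ZBeta →ₐ[ZBeta] RatField n :=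
    substVar i (algebraMap _ (RatField n) (X j : MvPolynomial (Fin n) ZBeta)) with hφ
  have h1 := congrArg φ (hf (Equiv.swap i j))
  have h2 : φ.comp (rename (Equiv.swap i j)) = φ := by
    refine MvPolynomial.algHom_ext fun k => ?_
    by_cases hki : k = i
    · subst hki
      simp [hφ, substVar, hij.ne']
    · by_cases hkj : k = j
      · subst hkj
        simp [hφ, substVar, hki]
      · simp [hφ, substVar, Equiv.swap_apply_of_ne_of_ne hki hkj]
  rw [← AlgHom.comp_apply, h2, Equiv.Perm.sign_swap hij.ne, map_mul, map_intCast] at h1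
  simp only [Units.val_neg, Units.val_one, Int.cast_neg, Int.cast_one, neg_mul, one_mul] at h1
  exact self_eq_neg.1 h1

lemma vandermondeProd_X_ne_zero :
    vandermondeProd (X : Fin n → MvPolynomial (Fin n) ZBeta) ≠ 0 :=
  vandermondeProd_ne_zero X_injective

/-- `GP_lam(x_1, …, x_n)` as a polynomial; it is `0` when `lam` has more than `n` parts. -/
def GPPoly (n : ℕ) (lam : StrictPartition) : MvPolynomial (Fin n) ZBeta :=
  (isAntisymmetric_numeratorPoly lam).vandermondeProd_dvd.choose

lemma vandermondeProd_mul_GPPoly (lam : StrictPartition) :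
    vandermondeProd X * GPPoly n lam = numeratorPoly n lam :=
  (isAntisymmetric_numeratorPoly lam).vandermondeProd_dvd.choose_spec.symm

/-- Distinct coordinates make the Vandermonde factor cancellable. Symmetry, stability and the
cancellation property are all read off from this formula at suitable points. -/
lemma aeval_GPPoly {K : Type*} [Field K] [Algebra ZBeta K] {x : Fin n → K}
    (hx : Function.Injective x) (lam : StrictPartition) :
    aeval x (GPPoly n lam) = embeddingSum (betaIn K) x lam := by
  have h := congrArg (aeval x) (vandermondeProd_mul_GPPoly (n := n) lam)
  rw [map_mul, map_vandermondeProd, aeval_numeratorPoly hx] at h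
  simp only [aeval_X] at h
  exact mul_left_cancel₀ (vandermondeProd_ne_zero hx) h

lemma algebraMap_GPPoly (lam : StrictPartition) :
    algebraMap _ (RatField n) (GPPoly n lam) =
      embeddingSum (betaIn (RatField n)) (ratVar n) lam := by
  rw [← aeval_ratVar, aeval_GPPoly ratVar_injective]

lemma algebraMap_GPPoly_eq_GP {lam : StrictPartition} (h : lam.length ≤ n) :
    algebraMap _ (RatField n) (GPPoly n lam) = GP n lam := by
  rw [algebraMap_GPPoly, GP, factorialGP_eq_embeddingSum _ _ _ h]

lemma GPPoly_eq_zero {lam : StrictPartition} (h : n < lam.length) : GPPoly n lam = 0 := by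
  apply FaithfulSMul.algebraMap_injective (MvPolynomial (Fin n) ZBeta) (RatField n)
  rw [algebraMap_GPPoly, embeddingSum_eq_zero_of_lt _ _ _ h, map_zero]

lemma isSymmetric_GPPoly (lam : StrictPartition) : (GPPoly n lam).IsSymmetric := by
  intro σ
  apply FaithfulSMul.algebraMap_injective (MvPolynomial (Fin n) ZBeta) (RatField n)
  rw [algebraMap_rename, aeval_GPPoly (ratVar_injective.comp σ.injective),
    embeddingSum_comp_perm, algebraMap_GPPoly]

lemma snoc_ratVar_injective : Function.Injective
    (Fin.snoc (α := fun _ => RatField n) (ratVar n) 0 : Fin (n + 1) → RatField n) := by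
  rw [Fin.snoc_injective_iff]
  exact ⟨ratVar_injective, fun ⟨i, hi⟩ => ratVar_ne_zero i hi⟩

lemma specializeLast_GPPoly (lam : StrictPartition) :
    specializeLast n (GPPoly (n + 1) lam) = GPPoly n lam := by
  apply FaithfulSMul.algebraMap_injective (MvPolynomial (Fin n) ZBeta) (RatField n)
  have h : (aeval (ratVar n)).comp (specializeLast n) =
      aeval (Fin.snoc (α := fun _ => RatField n) (ratVar n) 0 : Fin (n + 1) → RatField n) := by
    refine MvPolynomial.algHom_ext fun k => ?_
    refine Fin.lastCases ?_ (fun k => ?_) k <;> simp [specializeLast]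
  rw [← aeval_ratVar, ← AlgHom.comp_apply, h, aeval_GPPoly snoc_ratVar_injective,
    embeddingSum_snoc_zero _ _ ratVar_ne_zero, algebraMap_GPPoly]

end GPPoly

/-! ### The cancellation property -/

section Cancellation

variable {n : ℕ}

/-- Multiplication by 1 + βt turns y ⊕ s into y - t, y - s into y ⊕ t, and 1 + βs into 1, so the two
fractions are reciprocal. -/
lemma oplus_mul_ominus_eq_one {K : Type*} [Field K] {β y t s : K} (ht : 1 + β * t ≠ 0)
    (hs : s = ominus β 0 t) (h1 : y ≠ t) (h2 : y ≠ s) :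
    oplus β y t / ominus β y t * (oplus β y s / ominus β y s) = 1 := by
  have hs' : s * (1 + β * t) = -t := by
    rw [hs, ominus, div_mul_cancel₀ _ ht, zero_sub]
  rw [oplus_div_ominus, oplus_div_ominus, div_mul_div_comm, div_eq_one_iff_eq]
  · apply mul_right_cancel₀ (mul_ne_zero ht ht)
    rw [oplus, oplus]
    have e1 : (y + s + β * y * s) * (1 + β * t) = y - t := by linear_combination (1 + β * y) * hs'
    have e2 : (1 + β * s) * (1 + β * t) = 1 := by linear_combination β * hs'
    have e3 : (y - s) * (1 + β * t) = y + t + β * y * t := by linear_combination -hs'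
    linear_combination (y + t + β * y * t) * (1 + β * t) * (e1 * (1 + β * s) * (1 + β * t)
      + (y - t) * e2) - (y - t) * (1 + β * t) * e3
  · exact mul_ne_zero (sub_ne_zero.2 h1) (sub_ne_zero.2 h2)

lemma oplus_self_ominus {K : Type*} [Field K] {β t : K} (ht : 1 + β * t ≠ 0) :
    oplus β t (ominus β 0 t) = 0 := by
  have hs : ominus β 0 t * (1 + β * t) = -t := by
    rw [ominus, div_mul_cancel₀ _ ht, zero_sub]
  rw [oplus]
  linear_combination hs

/-- The point of the substitution `substCancel`. -/
def cancelPoint (n : ℕ) (i j : Fin n) : Fin n → RatFunc (RatField n) :=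
  Function.update
    (Function.update (fun k => RatFunc.C (ratVar n k)) i RatFunc.X)
    j (ominus (betaIn (RatFunc (RatField n))) 0 RatFunc.X)

lemma substCancel_eq_aeval (i j : Fin n) : substCancel n i j = aeval (cancelPoint n i j) := rfl

lemma betaIn_ratFunc : betaIn (RatFunc (RatField n)) = RatFunc.C (betaIn (RatField n)) :=
  RatFunc_C_algebraMap_ZBeta n _

lemma ratFunc_X_ne_C {F : Type*} [Field F] (c : F) : (RatFunc.X : RatFunc F) ≠ RatFunc.C c := by
  rw [← RatFunc.algebraMap_X, ← RatFunc.algebraMap_C]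
  intro h
  exact Polynomial.X_ne_C c (RatFunc.algebraMap_injective F h)

lemma ratFunc_one_add_mul_X_ne_zero {F : Type*} [Field F] (c : F) :
    1 + RatFunc.C c * (RatFunc.X : RatFunc F) ≠ 0 := by
  rw [← RatFunc.algebraMap_X, ← RatFunc.algebraMap_C, ← map_one (algebraMap (Polynomial F) _),
    ← map_mul, ← map_add]
  refine (map_ne_zero_iff _ (RatFunc.algebraMap_injective F)).2 fun h => ?_
  have := congrArg (Polynomial.eval 0) h
  simp at this

lemma ratFunc_ominus_ne_C {F : Type*} [Field F] (b c : F) :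
    ominus (RatFunc.C b) 0 (RatFunc.X : RatFunc F) ≠ RatFunc.C c := by
  rw [ominus, ne_eq, div_eq_iff (ratFunc_one_add_mul_X_ne_zero b), zero_sub,
    ← RatFunc.algebraMap_X, ← RatFunc.algebraMap_C, ← RatFunc.algebraMap_C,
    ← map_one (algebraMap (Polynomial F) _), ← map_neg, ← map_mul, ← map_add, ← map_mul]
  intro h
  have h := RatFunc.algebraMap_injective F h
  have hc := congrArg (Polynomial.eval 0) h
  simp only [Polynomial.eval_neg, Polynomial.eval_X, Polynomial.eval_mul, Polynomial.eval_C,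
    Polynomial.eval_add, Polynomial.eval_one, mul_zero, add_zero, mul_one, neg_zero] at hc
  rw [← hc] at h
  simp at h

lemma ratFunc_X_ne_ominus {F : Type*} [Field F] [CharZero F] (b : F) :
    (RatFunc.X : RatFunc F) ≠ ominus (RatFunc.C b) 0 RatFunc.X := by
  rw [ominus, ne_eq, eq_div_iff (ratFunc_one_add_mul_X_ne_zero b), zero_sub,
    ← RatFunc.algebraMap_X, ← RatFunc.algebraMap_C,
    ← map_one (algebraMap (Polynomial F) _), ← map_neg, ← map_mul, ← map_add, ← map_mul]
  intro h
  have h := congrArg (fun p => Polynomial.coeff p 1) (RatFunc.algebraMap_injective F h)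
  simp [mul_add, Polynomial.coeff_X_mul] at h
  norm_num [self_eq_neg] at h

lemma cancelPoint_left {i j : Fin n} (h : i ≠ j) : cancelPoint n i j i = RatFunc.X := by
  simp [cancelPoint, h]

lemma cancelPoint_right (i j : Fin n) :
    cancelPoint n i j j = ominus (betaIn (RatFunc (RatField n))) 0 RatFunc.X := by
  simp [cancelPoint]

lemma cancelPoint_of_ne {i j k : Fin n} (hi : k ≠ i) (hj : k ≠ j) :
    cancelPoint n i j k = RatFunc.C (ratVar n k) := by
  simp [cancelPoint, hi, hj]

lemma cancelPoint_injective {i j : Fin n} (h : i ≠ j) :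
    Function.Injective (cancelPoint n i j) := by
  have hX : ∀ c, (RatFunc.X : RatFunc (RatField n)) ≠ RatFunc.C c := ratFunc_X_ne_C
  have hO : ∀ c, ominus (betaIn (RatFunc (RatField n))) 0 (RatFunc.X : RatFunc (RatField n)) ≠
      RatFunc.C c := by rw [betaIn_ratFunc]; exact ratFunc_ominus_ne_C _
  have hXO : (RatFunc.X : RatFunc (RatField n)) ≠
      ominus (betaIn (RatFunc (RatField n))) 0 RatFunc.X := by
    rw [betaIn_ratFunc]; exact ratFunc_X_ne_ominus _
  intro k l hkl
  by_cases hki : k = i <;> by_cases hkj : k = j <;> by_cases hli : l = i <;>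
    by_cases hlj : l = j <;> try subst_vars
  all_goals try rfl
  all_goals try exact absurd rfl h
  all_goals try simp only [cancelPoint_left h, cancelPoint_right] at hkl
  all_goals first
    | exact absurd hkl hXO
    | exact absurd hkl.symm hXO
    | skip
  · rw [cancelPoint_of_ne hli hlj] at hkl; exact absurd hkl (hX _)
  · rw [cancelPoint_of_ne hli hlj] at hkl; exact absurd hkl (hO _)
  · rw [cancelPoint_of_ne hki hkj] at hkl; exact absurd hkl.symm (hX _)
  · rw [cancelPoint_of_ne hki hkj] at hkl; exact absurd hkl.symm (hO _)
  · rw [cancelPoint_of_ne hki hkj, cancelPoint_of_ne hli hlj] at hkl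
    exact ratVar_injective (RatFunc.C.injective hkl)

end Cancellation

/-! ### Membership in `GΓ_n` and its divisibility criterion -/

section CancellationProperty

variable {n : ℕ}

/-- Whichever of u and v is selected first, the other is still among its partners and gives a zero
factor. -/
lemma embeddingTerm_eq_zero {K : Type*} [Field K] {β : K} {x : Fin n → K} {u v : Fin n}
    (huv : u ≠ v) (h1 : oplus β (x u) (x v) = 0) (h2 : oplus β (x v) (x u) = 0) {r : ℕ}
    (p : List ℕ) (e : Fin r ↪ Fin n) {a : Fin r} (ha : e a = u) :
    embeddingTerm β x p e = 0 := by
  by_cases hb : ∃ b ≤ a, e b = v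
  · obtain ⟨b, hba, hb⟩ := hb
    refine prod_eq_zero (mem_univ b) (mul_eq_zero_of_right _ (prod_eq_zero (i := u) ?_ ?_))
    · refine mem_filter.2 ⟨mem_univ _, fun c hc hcu => huv ?_⟩
      have hca : c = a := e.injective (hcu.trans ha.symm)
      rw [← ha, ← hb, le_antisymm (hca ▸ hc) hba]
    · rw [hb, h2, zero_div]
  · push Not at hb
    refine prod_eq_zero (mem_univ a) (mul_eq_zero_of_right _ (prod_eq_zero (i := v) ?_ ?_))
    · exact mem_filter.2 ⟨mem_univ _, hb⟩
    · rw [ha, h1, zero_div]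

/-- Choices selecting i or j vanish. In every other one, t and ⊖t are partners of each selected
variable, and their two factors multiply to 1. -/
lemma substCancel_GPPoly {i j : Fin n} (hij : i ≠ j) (lam : StrictPartition) :
    ∃ c : RatField n, substCancel n i j (GPPoly n lam) = RatFunc.C c := by
  have hinj := cancelPoint_injective hij
  have ht : 1 + betaIn (RatFunc (RatField n)) * RatFunc.X ≠ 0 := by
    rw [betaIn_ratFunc]; exact ratFunc_one_add_mul_X_ne_zero _
  rw [substCancel_eq_aeval, aeval_GPPoly hinj]
  suffices h : embeddingSum (betaIn (RatFunc (RatField n))) (cancelPoint n i j) lam ∈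
      (RatFunc.C : RatField n →+* RatFunc (RatField n)).fieldRange by
    obtain ⟨c, hc⟩ := h
    exact ⟨c, hc.symm⟩
  have h0 : oplus (betaIn (RatFunc (RatField n))) (cancelPoint n i j i) (cancelPoint n i j j) =
      0 := by
    rw [cancelPoint_left hij, cancelPoint_right, oplus_self_ominus ht]
  have h0' : oplus (betaIn (RatFunc (RatField n))) (cancelPoint n i j j) (cancelPoint n i j i) =
      0 := by
    rw [← h0, oplus, oplus]; ring
  refine sum_mem fun e _ => ?_
  by_cases hi : ∃ a, e a = i
  · obtain ⟨a, ha⟩ := hi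
    rw [embeddingTerm_eq_zero hij h0 h0' _ e ha]
    exact zero_mem _
  by_cases hj : ∃ a, e a = j
  · obtain ⟨a, ha⟩ := hj
    rw [embeddingTerm_eq_zero hij.symm h0' h0 _ e ha]
    exact zero_mem _
  push Not at hi hj
  have hconst : ∀ k, k ≠ i → k ≠ j → cancelPoint n i j k ∈
      (RatFunc.C : RatField n →+* RatFunc (RatField n)).fieldRange := fun k hki hkj =>
    ⟨ratVar n k, (cancelPoint_of_ne hki hkj).symm⟩
  have hβ : betaIn (RatFunc (RatField n)) ∈
      (RatFunc.C : RatField n →+* RatFunc (RatField n)).fieldRange := ⟨_, betaIn_ratFunc.symm⟩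
  refine prod_mem fun a _ => mul_mem (pow_mem (hconst _ (hi a) (hj a)) _) ?_
  rw [← mul_prod_erase _ _ (mem_filter.2 ⟨mem_univ i, fun b _ => hi b⟩),
    ← mul_prod_erase _ _ (mem_erase.2 ⟨hij.symm, mem_filter.2 ⟨mem_univ j, fun b _ => hj b⟩⟩),
    ← mul_assoc, cancelPoint_left hij, cancelPoint_right, oplus_mul_ominus_eq_one ht rfl, one_mul]
  · refine prod_mem fun k hk => ?_
    have hx := hconst _ (hi a) (hj a)
    have hy := hconst k (mem_erase.1 (mem_erase.1 hk).2).1 (mem_erase.1 hk).1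
    exact div_mem (add_mem (add_mem hx hy) (mul_mem (mul_mem hβ hx) hy))
      (div_mem (sub_mem hx hy) (add_mem (one_mem _) (mul_mem hβ hy)))
  · rw [← cancelPoint_left hij]
    exact hinj.ne (hi a)
  · rw [← cancelPoint_right i j]
    exact hinj.ne (hj a)

lemma GPPoly_mem_GGamma (lam : StrictPartition) : GPPoly n lam ∈ GGamma n :=
  ⟨isSymmetric_GPPoly lam, fun _ _ hij => substCancel_GPPoly hij.ne lam⟩

/-- Evaluation `x_i ↦ T` in the polynomial ring over the field of fractions. -/
def substPoly (i : Fin n) : MvPolynomial (Fin n) ZBeta →ₐ[ZBeta] Polynomial (RatField n) :=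
  aeval (Function.update (fun k => Polynomial.C (ratVar n k)) i Polynomial.X)

lemma eval_substPoly (i : Fin n) (g : MvPolynomial (Fin n) ZBeta) :
    Polynomial.eval (ratVar n i) (substPoly i g) = algebraMap _ (RatField n) g := by
  have h : ((Polynomial.aeval (ratVar n i)).restrictScalars ZBeta).comp (substPoly i) =
      aeval (ratVar n) := by
    refine MvPolynomial.algHom_ext fun k => ?_
    by_cases hk : k = i
    · subst hk; simp [substPoly]
    · simp [substPoly, hk]
  rw [← aeval_ratVar, ← h]
  simp

lemma eval_zero_substPoly (i : Fin n) (g : MvPolynomial (Fin n) ZBeta) :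
    Polynomial.eval 0 (substPoly i g) = algebraMap _ (RatField n) (eraseVar i g) := by
  have h : ((Polynomial.aeval (0 : RatField n)).restrictScalars ZBeta).comp (substPoly i) =
      (aeval (ratVar n)).comp (eraseVar i) := by
    refine MvPolynomial.algHom_ext fun k => ?_
    by_cases hk : k = i
    · subst hk; simp [substPoly, eraseVar_X_self]
    · simp [substPoly, hk, eraseVar_X_of_ne hk]
  have := DFunLike.congr_fun h g
  rw [← aeval_ratVar, ← AlgHom.comp_apply, ← this]
  simp

lemma substCancel_of_eraseVar_eq {i j : Fin n} (hij : i ≠ j) {g : MvPolynomial (Fin n) ZBeta}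
    (hg : eraseVar j g = g) :
    substCancel n i j g = algebraMap (Polynomial (RatField n)) _ (substPoly i g) := by
  have h : (substCancel n i j).comp (eraseVar j) =
      ((IsScalarTower.toAlgHom ZBeta (Polynomial (RatField n)) (RatFunc (RatField n))).comp
        (substPoly i)).comp (eraseVar j) := by
    refine MvPolynomial.algHom_ext fun k => ?_
    by_cases hk : k = j
    · subst hk; simp [eraseVar_X_self]
    · by_cases hki : k = i
      · subst hki
        simp [eraseVar_X_of_ne hk, substCancel, substPoly, hk]
      · simp [eraseVar_X_of_ne hk, substCancel, substPoly, hk, hki]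
  have := DFunLike.congr_fun h g
  simpa [hg] using this

lemma substCancel_oplusPoly {i j : Fin n} (hij : i ≠ j) :
    substCancel n i j (oplusPoly i j) = 0 := by
  have ht : 1 + betaIn (RatFunc (RatField n)) * RatFunc.X ≠ 0 := by
    rw [betaIn_ratFunc]; exact ratFunc_one_add_mul_X_ne_zero _
  rw [substCancel_eq_aeval, oplusPoly]
  simp only [map_add, map_mul, aeval_X, aeval_betaPoly]
  rw [cancelPoint_left hij, cancelPoint_right]
  exact oplus_self_ominus ht

lemma eraseVar_comm (i j : Fin n) (f : MvPolynomial (Fin n) ZBeta) :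
    eraseVar i (eraseVar j f) = eraseVar j (eraseVar i f) := by
  have h : (eraseVar i).comp (eraseVar j) =
      ((eraseVar j).comp (eraseVar i) : MvPolynomial (Fin n) ZBeta →ₐ[ZBeta] _) := by
    refine MvPolynomial.algHom_ext fun k => ?_
    by_cases hi : k = i <;> by_cases hj : k = j
    · rw [← hi, ← hj]
    · subst hi; simp [eraseVar_X_of_ne hj, eraseVar_X_self]
    · subst hj; simp [eraseVar_X_of_ne hi, eraseVar_X_self]
    · simp [eraseVar_X_of_ne hi, eraseVar_X_of_ne hj]
  exact DFunLike.congr_fun h f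

lemma eraseVar_idem (i : Fin n) (f : MvPolynomial (Fin n) ZBeta) :
    eraseVar i (eraseVar i f) = eraseVar i f := by
  have h : (eraseVar i).comp (eraseVar i) =
      (eraseVar i : MvPolynomial (Fin n) ZBeta →ₐ[ZBeta] _) := by
    refine MvPolynomial.algHom_ext fun k => ?_
    by_cases hi : k = i
    · subst hi; simp [eraseVar_X_self]
    · simp [eraseVar_X_of_ne hi]
  exact DFunLike.congr_fun h f

/-- Independence of `t` in `f(…, t, …, ⊖ t, …)`, as a divisibility between polynomials. -/
lemma exists_substCancel_eq_C_iff {i j : Fin n} (hij : i ≠ j) (f : MvPolynomial (Fin n) ZBeta) :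
    (∃ c : RatField n, substCancel n i j f = RatFunc.C c) ↔
      oplusPoly i j ∣ f - eraseVar i (eraseVar j f) := by
  set f₀ := eraseVar i (eraseVar j f) with hf₀
  have hi : eraseVar i f₀ = f₀ := eraseVar_idem _ _
  have hj : eraseVar j f₀ = f₀ := by rw [hf₀, eraseVar_comm, eraseVar_idem]
  constructor
  · rintro ⟨c, hc⟩
    obtain ⟨N, g, hg, h, hh⟩ := exists_pow_mul_sub_dvd (i := j)
      (eraseVar_one_add_betaPoly hij) (eraseVar_X_of_ne hij) f
    rw [← oplusPoly_eq_linear] at hh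
    have h1 := congrArg (substCancel n i j) hh
    rw [map_mul, substCancel_oplusPoly hij, zero_mul, map_sub, map_mul, hc,
      substCancel_of_eraseVar_eq hij hg, map_pow, substCancel_of_eraseVar_eq hij
      (eraseVar_one_add_betaPoly hij), ← RatFunc.algebraMap_C, ← map_pow, ← map_mul,
      ← map_sub, map_eq_zero_iff _ (RatFunc.algebraMap_injective _), sub_eq_zero] at h1
    -- At t = 0 also ⊖t = 0, so the constant c must be f₀.
    have h2 := congrArg (Polynomial.eval 0) h1
    rw [Polynomial.eval_mul, Polynomial.eval_pow, Polynomial.eval_C, eval_zero_substPoly,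
      eval_zero_substPoly] at h2
    have h3 : eraseVar i g = f₀ := by
      have := congrArg (fun q => eraseVar i (eraseVar j q)) hh
      simp only [map_sub, map_mul, map_pow, hg, eraseVar_one_add_betaPoly hij] at this
      simp only [oplusPoly, map_add, map_mul, map_one, eraseVar_X_self, eraseVar_X_of_ne hij,
        mul_zero, add_zero, zero_mul, one_pow, one_mul, ← hf₀] at this
      exact (sub_eq_zero.1 this).symm
    have h4 : c = algebraMap _ (RatField n) f₀ := by
      rw [← h3, ← h2]
      simp [eraseVar_X_self]
    have h5 : g = (1 + betaPoly n * X i) ^ N * f₀ := by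
      -- Putting T = x_i back turns the identity in T into one between polynomials.
      have h6 := congrArg (Polynomial.eval (ratVar n i)) h1
      rw [Polynomial.eval_mul, Polynomial.eval_pow, Polynomial.eval_C, eval_substPoly,
        eval_substPoly, h4, ← map_pow, ← map_mul] at h6
      exact (FaithfulSMul.algebraMap_injective _ _ h6).symm
    have h7 : oplusPoly i j ∣ (1 + betaPoly n * X i) ^ N * (f - f₀) :=
      ⟨h, by rw [← hh, h5]; ring⟩
    have hco := isCoprime_oplusPoly i j
    rw [← oplusPoly_eq_linear] at hco
    exact hco.pow_right.dvd_of_dvd_mul_left h7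
  · rintro ⟨q, hq⟩
    refine ⟨algebraMap _ (RatField n) f₀, ?_⟩
    have h1 := congrArg (substCancel n i j) hq
    rw [map_mul, substCancel_oplusPoly hij, zero_mul, map_sub, sub_eq_zero,
      substCancel_of_eraseVar_eq hij hj] at h1
    rw [h1, ← RatFunc.algebraMap_C]
    congr 1
    -- Since f₀ does not involve x_i, its image is constant in T.
    have h : (substPoly i).comp (eraseVar i) =
        ((IsScalarTower.toAlgHom ZBeta (RatField n) (Polynomial (RatField n))).comp
          (aeval (ratVar n))).comp (eraseVar i) := by
      refine MvPolynomial.algHom_ext fun k => ?_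
      by_cases hk : k = i
      · subst hk; simp [eraseVar_X_self]
      · simp [eraseVar_X_of_ne hk, substPoly, hk]
    have := DFunLike.congr_fun h f₀
    simp only [AlgHom.comp_apply, hi, aeval_ratVar] at this
    exact this

lemma mem_GGamma_iff {f : MvPolynomial (Fin n) ZBeta} :
    f ∈ GGamma n ↔ f.IsSymmetric ∧
      ∀ i j : Fin n, i < j → oplusPoly i j ∣ f - eraseVar i (eraseVar j f) := by
  refine and_congr_right fun _ => forall₃_congr fun i j hij => ?_
  exact exists_substCancel_eq_C_iff hij.ne f

lemma specializeLast_X_castSucc (i : Fin n) : specializeLast n (X i.castSucc) = X i := by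
  simp [specializeLast]

lemma specializeLast_X_last : specializeLast n (X (Fin.last n)) = 0 := by
  simp [specializeLast]

lemma specializeLast_betaPoly : specializeLast n (betaPoly (n + 1)) = betaPoly n := by
  simp [specializeLast, betaPoly]

lemma specializeLast_eraseVar (i : Fin n) (f : MvPolynomial (Fin (n + 1)) ZBeta) :
    specializeLast n (eraseVar i.castSucc f) = eraseVar i (specializeLast n f) := by
  have h : (specializeLast n).comp (eraseVar i.castSucc) =
      (eraseVar i).comp (specializeLast n) := by
    refine MvPolynomial.algHom_ext fun k => ?_
    refine Fin.lastCases ?_ (fun k => ?_) k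
    · simp [eraseVar_X_of_ne (Fin.castSucc_lt_last i).ne', specializeLast_X_last]
    · by_cases hk : k = i
      · subst hk
        simp [specializeLast_X_castSucc, eraseVar_X_self]
      · rw [AlgHom.comp_apply, AlgHom.comp_apply,
          eraseVar_X_of_ne ((Fin.castSucc_injective n).ne hk), specializeLast_X_castSucc,
          eraseVar_X_of_ne hk]
  exact DFunLike.congr_fun h f

/-- Extension of a permutation by the fixed point `n`. -/
lemma exists_perm_castSucc (σ : Equiv.Perm (Fin n)) : ∃ τ : Equiv.Perm (Fin (n + 1)),
    τ (Fin.last n) = Fin.last n ∧ ∀ i : Fin n, τ i.castSucc = (σ i).castSucc := by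
  obtain ⟨τ, hτ⟩ := Equiv.Perm.exists_extending_pair
    (Fin.snoc (α := fun _ => Fin (n + 1)) Fin.castSucc (Fin.last n))
    (Fin.snoc (α := fun _ => Fin (n + 1)) (fun i => (σ i).castSucc) (Fin.last n))
    (Fin.snoc_injective_iff.2 ⟨Fin.castSucc_injective n, by simp⟩)
    (Fin.snoc_injective_iff.2 ⟨(Fin.castSucc_injective n).comp σ.injective, by simp⟩)
  exact ⟨τ, by simpa using hτ (Fin.last n), fun i => by simpa using hτ i.castSucc⟩

lemma specializeLast_mem_GGamma {f : MvPolynomial (Fin (n + 1)) ZBeta} (hf : f ∈ GGamma (n + 1)) :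
    specializeLast n f ∈ GGamma n := by
  rw [mem_GGamma_iff] at hf ⊢
  refine ⟨fun σ => ?_, fun i j hij => ?_⟩
  · obtain ⟨τ, hτ, hτ'⟩ := exists_perm_castSucc σ
    have h : (rename σ).comp (specializeLast n) = (specializeLast n).comp (rename τ) := by
      refine MvPolynomial.algHom_ext fun k => ?_
      refine Fin.lastCases ?_ (fun k => ?_) k
      · simp [specializeLast_X_last, hτ]
      · simp [specializeLast_X_castSucc, hτ']
    have := DFunLike.congr_fun h f
    rw [AlgHom.comp_apply, AlgHom.comp_apply, hf.1 τ] at this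
    exact this
  · have := map_dvd (specializeLast n) (hf.2 i.castSucc j.castSucc
      (Fin.castSucc_lt_castSucc_iff.2 hij))
    rwa [map_sub, specializeLast_eraseVar, specializeLast_eraseVar, oplusPoly, map_add, map_add,
      map_mul, map_mul, specializeLast_X_castSucc, specializeLast_X_castSucc,
      specializeLast_betaPoly] at this

lemma X_last_dvd_of_specializeLast_eq_zero {f : MvPolynomial (Fin (n + 1)) ZBeta}
    (hf : specializeLast n f = 0) : X (Fin.last n) ∣ f := by
  have h : (rename Fin.castSucc).comp (specializeLast n) = eraseVar (Fin.last n) := by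
    refine MvPolynomial.algHom_ext fun k => ?_
    refine Fin.lastCases ?_ (fun k => ?_) k
    · simp [specializeLast_X_last, eraseVar_X_self]
    · simp [specializeLast_X_castSucc, eraseVar_X_of_ne (Fin.castSucc_lt_last k).ne]
  obtain ⟨N, g, hg, hd⟩ := exists_pow_mul_sub_dvd (i := Fin.last n) (map_one _) (map_zero _) f
  rw [one_mul, add_zero, one_pow, one_mul] at hd
  have hg0 : g = 0 := by
    obtain ⟨q, hq⟩ := hd
    have := congrArg (eraseVar (Fin.last n)) hq
    rw [map_sub, map_mul, eraseVar_X_self, zero_mul, hg, ← h, AlgHom.comp_apply, hf, map_zero,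
      zero_sub, neg_eq_zero] at this
    exact this
  rwa [hg0, sub_zero] at hd

lemma X_dvd_of_isSymmetric {f : MvPolynomial (Fin n) ZBeta} (hf : f.IsSymmetric) {i j : Fin n}
    (h : X i ∣ f) : X j ∣ f := by
  have := map_dvd (rename (Equiv.swap i j)) h
  rwa [rename_X, Equiv.swap_apply_left, hf] at this

lemma eraseVar_eq_zero_of_X_dvd {f : MvPolynomial (Fin n) ZBeta} {i : Fin n} (h : X i ∣ f) :
    eraseVar i f = 0 := by
  obtain ⟨q, rfl⟩ := h
  rw [map_mul, eraseVar_X_self, zero_mul]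

end CancellationProperty

/-! ### A basis of the antisymmetric polynomials -/

section Antisymmetric

variable {n : ℕ}

lemma IsAntisymmetric.add {f g : MvPolynomial (Fin n) ZBeta} (hf : IsAntisymmetric f)
    (hg : IsAntisymmetric g) : IsAntisymmetric (f + g) := fun σ => by
  rw [map_add, hf σ, hg σ, mul_add]

lemma IsAntisymmetric.smul {f : MvPolynomial (Fin n) ZBeta} (hf : IsAntisymmetric f) (c : ZBeta) :
    IsAntisymmetric (c • f) := fun σ => by
  rw [map_smul, hf σ, mul_smul_comm]

lemma IsAntisymmetric.sum {ι : Type*} {s : Finset ι} {f : ι → MvPolynomial (Fin n) ZBeta}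
    (hf : ∀ i ∈ s, IsAntisymmetric (f i)) : IsAntisymmetric (∑ i ∈ s, f i) := fun σ => by
  rw [map_sum, mul_sum]
  exact sum_congr rfl fun i hi => hf i hi σ

lemma IsAntisymmetric.coeff_mapDomain {f : MvPolynomial (Fin n) ZBeta} (hf : IsAntisymmetric f)
    (σ : Equiv.Perm (Fin n)) (m : Fin n →₀ ℕ) :
    coeff (m.mapDomain σ) f = (Equiv.Perm.sign σ : ℤ) * coeff m f := by
  have h := coeff_rename_mapDomain σ σ.injective f m
  have h1 : (C ((Equiv.Perm.sign σ : ℤ) : ZBeta) : MvPolynomial (Fin n) ZBeta) =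
      ((Equiv.Perm.sign σ : ℤ) : MvPolynomial (Fin n) ZBeta) := by simp
  have hs : ((Equiv.Perm.sign σ : ℤ) : ZBeta) * (Equiv.Perm.sign σ : ℤ) = 1 := by
    rw [← Int.cast_mul, ← Units.val_mul, Int.units_mul_self]; simp
  rw [hf σ, ← h1, coeff_C_mul] at h
  rw [← h, ← mul_assoc, hs, one_mul]

lemma mapDomain_perm_apply (σ : Equiv.Perm (Fin n)) (m : Fin n →₀ ℕ) (i : Fin n) :
    m.mapDomain σ (σ i) = m i := Finsupp.mapDomain_apply σ.injective _ _

lemma degree_mapDomain_perm (σ : Equiv.Perm (Fin n)) (m : Fin n →₀ ℕ) :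
    (m.mapDomain σ).degree = m.degree := by
  rw [Finsupp.degree_eq_sum, Finsupp.degree_eq_sum, ← Equiv.sum_comp σ]
  exact sum_congr rfl fun i _ => mapDomain_perm_apply σ m i

lemma exists_strictAnti_mapDomain {m : Fin n →₀ ℕ} (hm : Function.Injective m) :
    ∃ σ : Equiv.Perm (Fin n), StrictAnti (m.mapDomain σ) := by
  set g : Fin n → ℕᵒᵈ := fun i => OrderDual.toDual (m i)
  have hg : Monotone (g ∘ Tuple.sort g) := Tuple.monotone_sort g
  refine ⟨(Tuple.sort g).symm, fun i j hij => ?_⟩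
  have hval : ∀ k, m.mapDomain (Tuple.sort g).symm k = m (Tuple.sort g k) := fun k => by
    have := mapDomain_perm_apply (Tuple.sort g).symm m (Tuple.sort g k)
    rwa [Equiv.symm_apply_apply] at this
  rw [hval, hval]
  exact lt_of_le_of_ne (hg hij.le) fun h => hij.ne' ((Tuple.sort g).injective (hm h))

/-- Distinct exponents can be sorted at the cost of a sign. With a repeated exponent, a
transposition shows that the coefficient is its own negative. -/
lemma IsAntisymmetric.coeff_eq_zero {f : MvPolynomial (Fin n) ZBeta} (hf : IsAntisymmetric f)
    {d : ℕ} (h : ∀ c : Fin n →₀ ℕ, StrictAnti c → c.degree = d → coeff c f = 0)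
    {m : Fin n →₀ ℕ} (hm : m.degree = d) : coeff m f = 0 := by
  by_cases hinj : Function.Injective m
  · obtain ⟨σ, hσ⟩ := exists_strictAnti_mapDomain hinj
    have h1 := h _ hσ ((degree_mapDomain_perm σ m).trans hm)
    rw [hf.coeff_mapDomain] at h1
    refine (mul_eq_zero.1 h1).resolve_left ?_
    exact Int.cast_ne_zero.2 (Units.ne_zero _)
  · obtain ⟨i, j, hij, hne⟩ := Function.not_injective_iff.1 hinj
    have h1 : m.mapDomain (Equiv.swap i j) = m := by
      ext k
      obtain ⟨l, rfl⟩ := (Equiv.swap i j).surjective k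
      rw [mapDomain_perm_apply]
      rcases eq_or_ne l i with rfl | hl
      · rw [Equiv.swap_apply_left, hij]
      · rcases eq_or_ne l j with rfl | hl'
        · rw [Equiv.swap_apply_right, hij]
        · rw [Equiv.swap_apply_of_ne_of_ne hl hl']
    have h2 := hf.coeff_mapDomain (Equiv.swap i j) m
    rw [h1, Equiv.Perm.sign_swap hne] at h2
    simp only [Units.val_neg, Units.val_one, Int.cast_neg, Int.cast_one, neg_mul, one_mul] at h2
    exact self_eq_neg.1 h2

/-- The determinant `det (x_i^{b_j} (1 + β x_i)^j)`. -/
def altSum (b : Fin n →₀ ℕ) : MvPolynomial (Fin n) ZBeta :=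
  ∑ w : Equiv.Perm (Fin n), ((Equiv.Perm.sign w : ℤ) : MvPolynomial (Fin n) ZBeta) *
    ∏ i, (X (w i) ^ b i * (1 + betaPoly n * X (w i)) ^ (i : ℕ))

lemma isAntisymmetric_altSum (b : Fin n →₀ ℕ) : IsAntisymmetric (altSum b) := by
  intro σ
  have hs : ((Equiv.Perm.sign σ : ℤ) : MvPolynomial (Fin n) ZBeta) *
      (Equiv.Perm.sign σ : ℤ) = 1 := by
    rw [← Int.cast_mul, ← Units.val_mul, Int.units_mul_self]; simp
  rw [altSum, map_sum, mul_sum]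
  refine Fintype.sum_equiv (Equiv.mulLeft σ) _ _ fun w => ?_
  simp only [map_mul, map_prod, map_intCast, map_pow, map_add, map_one, rename_X, betaPoly,
    rename_C, Equiv.coe_mulLeft, Equiv.Perm.mul_apply, Units.val_mul, Int.cast_mul]
  rw [← mul_assoc, ← mul_assoc, hs, one_mul]

lemma X_dvd_altSum {b : Fin n →₀ ℕ} (hb : ∀ i, 0 < b i) (k : Fin n) : X k ∣ altSum b := by
  refine dvd_sum fun w _ => Dvd.dvd.mul_left ?_ _
  refine (Dvd.dvd.mul_right ?_ _).trans (dvd_prod_of_mem _ (mem_univ (w.symm k)))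
  rw [Equiv.apply_symm_apply]
  exact dvd_pow_self _ (hb _).ne'

lemma prod_X_pow_eq_monomial (w : Equiv.Perm (Fin n)) (b : Fin n →₀ ℕ) :
    ∏ i, (X (w i) : MvPolynomial (Fin n) ZBeta) ^ b i = monomial (b.mapDomain w) 1 := by
  rw [monomial_eq, C_1, one_mul, Finsupp.prod_fintype _ _ (fun _ => pow_zero _),
    ← Equiv.prod_comp w fun j => X j ^ b.mapDomain w j]
  exact prod_congr rfl fun i _ => by rw [mapDomain_perm_apply]

lemma eq_of_le_of_degree_le {b c : Fin n →₀ ℕ} (h : b ≤ c) (hd : c.degree ≤ b.degree) :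
    b = c := by
  rw [Finsupp.degree_eq_sum, Finsupp.degree_eq_sum] at hd
  have h1 := (sum_eq_sum_iff_of_le fun i (_ : i ∈ univ) => h i).1
    (le_antisymm (sum_le_sum fun i _ => h i) hd)
  exact Finsupp.ext fun i => h1 i (mem_univ i)

/-- In lowest degree each (1 + βx)^i contributes only its constant term 1, which leaves the ordinary
alternant of x^b. -/
lemma coeff_altSum_of_degree_le {b c : Fin n →₀ ℕ} (h : c.degree ≤ b.degree) :
    coeff c (altSum b) =
      ∑ w : Equiv.Perm (Fin n), if b.mapDomain w = c then ((Equiv.Perm.sign w : ℤ) : ZBeta)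
        else 0 := by
  rw [altSum, coeff_sum]
  refine sum_congr rfl fun w _ => ?_
  have h1 : (C ((Equiv.Perm.sign w : ℤ) : ZBeta) : MvPolynomial (Fin n) ZBeta) =
      ((Equiv.Perm.sign w : ℤ) : MvPolynomial (Fin n) ZBeta) := by simp
  rw [← h1, coeff_C_mul, prod_mul_distrib, prod_X_pow_eq_monomial, coeff_monomial_mul', one_mul]
  by_cases hbc : b.mapDomain w = c
  · rw [if_pos hbc.le, if_pos hbc, hbc, tsub_self, ← constantCoeff_eq, map_prod]
    simp [betaPoly]
  · rw [if_neg hbc, if_neg, mul_zero]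
    exact fun hle => hbc (eq_of_le_of_degree_le hle (h.trans_eq (degree_mapDomain_perm w b).symm))

lemma coeff_altSum_of_degree_lt {b c : Fin n →₀ ℕ} (h : c.degree < b.degree) :
    coeff c (altSum b) = 0 := by
  rw [coeff_altSum_of_degree_le h.le]
  refine sum_eq_zero fun w _ => if_neg ?_
  rintro rfl
  exact h.ne (degree_mapDomain_perm w b)

lemma coeff_altSum_of_strictAnti {b c : Fin n →₀ ℕ} (h : c.degree ≤ b.degree)
    (hb : StrictAnti b) (hc : StrictAnti c) : coeff c (altSum b) = if b = c then 1 else 0 := by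
  rw [coeff_altSum_of_degree_le h, sum_eq_single 1]
  · simp
  · refine fun w _ hw => if_neg ?_
    rintro rfl
    -- A permutation carrying one strictly decreasing exponent to another is increasing, hence the
    -- identity.
    have hmono : StrictMono w := ?_
    · exact hw (Equiv.ext fun i => congrFun ((hmono.range_inj strictMono_id).1 (by simp)) i)
    intro i j hij
    rw [← hc.lt_iff_gt, mapDomain_perm_apply, mapDomain_perm_apply]
    exact hb hij
  · exact fun h => absurd (mem_univ _) h

lemma add_val_le_of_strictAnti {b : Fin n → ℕ} (hb : StrictAnti b) {N : ℕ} (hN : ∀ i, b i ≤ N)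
    (i : Fin n) : b i + i ≤ N := by
  obtain ⟨k, hk⟩ := i
  induction k with
  | zero => exact hN _
  | succ k ih =>
    have h1 := ih (by omega)
    have h2 : b ⟨k + 1, hk⟩ < b ⟨k, by omega⟩ := hb (by simp [Fin.lt_def])
    simp only at h1 ⊢
    omega

/-- Strict decrease gives b_i ≤ N - i, which leaves room for the i extra powers from (1 + βx)^i. The
bound makes the reduction in `mem_span_altSum` terminate. -/
lemma degreeOf_altSum_le {b : Fin n →₀ ℕ} (hb : StrictAnti b) {N : ℕ} (hN : ∀ i, b i ≤ N)
    (k : Fin n) : degreeOf k (altSum b) ≤ N := by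
  refine (degreeOf_sum_le _ _ _).trans (Finset.sup_le fun w _ => ?_)
  have h1 : (C ((Equiv.Perm.sign w : ℤ) : ZBeta) : MvPolynomial (Fin n) ZBeta) =
      ((Equiv.Perm.sign w : ℤ) : MvPolynomial (Fin n) ZBeta) := by simp
  have h2 : ∀ i, degreeOf k (1 + betaPoly n * X (w i)) ≤ if w i = k then 1 else 0 := fun i => by
    refine (degreeOf_add_le _ _ _).trans (max_le (by simp) ?_)
    refine (degreeOf_mul_le _ _ _).trans ?_
    rw [betaPoly, degreeOf_C, zero_add, degreeOf_X]
    simp [eq_comm]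
  have h3 : ∀ i, degreeOf k (X (w i) ^ b i * (1 + betaPoly n * X (w i)) ^ (i : ℕ)) ≤
      if w i = k then b i + i else 0 := fun i => by
    refine (degreeOf_mul_le _ _ _).trans ((add_le_add (degreeOf_pow_le _ _ _)
      ((degreeOf_pow_le _ _ _).trans (Nat.mul_le_mul_left _ (h2 i)))).trans ?_)
    rw [degreeOf_X]
    by_cases h : w i = k
    · rw [if_pos h, if_pos h, if_pos h.symm, mul_one, mul_one]
    · rw [if_neg h, if_neg h, if_neg (Ne.symm h), mul_zero, mul_zero, add_zero]
  rw [← h1]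
  refine (degreeOf_C_mul_le _ _ _).trans ((degreeOf_prod_le _ _ _).trans
    ((sum_le_sum fun i _ => h3 i).trans ?_))
  rw [sum_eq_single (w.symm k) (fun i _ hi => if_neg fun h => hi (by rw [← h]; simp)) (by simp),
    if_pos (by simp)]
  exact add_val_le_of_strictAnti hb hN _

lemma coeff_eq_zero_of_X_dvd {f : MvPolynomial (Fin n) ZBeta} {k : Fin n} (h : X k ∣ f)
    {m : Fin n →₀ ℕ} (hm : m k = 0) : coeff m f = 0 := by
  obtain ⟨q, rfl⟩ := h
  rw [coeff_X_mul', if_neg]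
  simpa using hm

/-- Alternants remove the lowest-degree part of f without raising the bound N on the degree in each
variable, so the process stops beyond total degree nN. -/
lemma mem_span_altSum {f : MvPolynomial (Fin n) ZBeta} (hf : IsAntisymmetric f)
    (hX : ∀ k, X k ∣ f) :
    f ∈ Submodule.span ZBeta
      (altSum '' {b : Fin n →₀ ℕ | StrictAnti b ∧ ∀ i, 0 < b i}) := by
  obtain ⟨N, hN⟩ : ∃ N, ∀ k, degreeOf k f ≤ N :=
    ⟨univ.sup fun k => degreeOf k f, fun k => le_sup (f := fun k => degreeOf k f) (mem_univ k)⟩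
  -- Here r counts the total degrees up to nN that may still occur.
  suffices H : ∀ (r : ℕ) (f : MvPolynomial (Fin n) ZBeta), IsAntisymmetric f → (∀ k, X k ∣ f) →
      (∀ k, degreeOf k f ≤ N) → (∀ m ∈ f.support, n * N + 1 ≤ m.degree + r) →
      f ∈ Submodule.span ZBeta (altSum '' {b : Fin n →₀ ℕ | StrictAnti b ∧ ∀ i, 0 < b i}) from
    H (n * N + 1) f hf hX hN fun m _ => by omega
  clear! f
  intro r
  induction r with
  | zero =>
    intro f _ _ hN hr
    have hf0 : f = 0 := by
      rw [← support_eq_empty, eq_empty_iff_forall_notMem]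
      intro m hm
      have h1 := hr m hm
      have h2 : m.degree ≤ n * N := by
        rw [Finsupp.degree_eq_sum]
        refine (sum_le_card_nsmul univ _ N fun i _ => ?_).trans (by simp)
        exact (degreeOf_le_iff.1 (hN i)) m hm
      omega
    rw [hf0]
    exact zero_mem _
  | succ r ih =>
    intro f hf hX hN hr
    classical
    set S := f.support.filter fun m : Fin n →₀ ℕ => StrictAnti m ∧ m.degree + r = n * N with hS
    have hSb : ∀ b : Fin n →₀ ℕ, b ∈ S → StrictAnti b ∧ b.degree + r = n * N ∧
        b ∈ f.support := fun b hb => ⟨(mem_filter.1 hb).2.1, (mem_filter.1 hb).2.2, (mem_filter.1 hb).1⟩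
    have hpos : ∀ b : Fin n →₀ ℕ, b ∈ S → ∀ i, 0 < b i := fun b hb i => Nat.pos_of_ne_zero fun h0 =>
      (mem_support_iff.1 (hSb b hb).2.2) (coeff_eq_zero_of_X_dvd (hX i) h0)
    set g := ∑ b ∈ S, coeff b f • altSum b with hg
    have hgmem : g ∈ Submodule.span ZBeta
        (altSum '' {b : Fin n →₀ ℕ | StrictAnti b ∧ ∀ i, 0 < b i}) :=
      sum_mem fun b hb => Submodule.smul_mem _ _
        (Submodule.subset_span ⟨b, ⟨(hSb b hb).1, hpos b hb⟩, rfl⟩)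
    have hganti : IsAntisymmetric g := IsAntisymmetric.sum fun b _ =>
      (isAntisymmetric_altSum b).smul _
    have hsub : IsAntisymmetric (f - g) := by
      have := hf.add (hganti.smul (-1))
      rwa [neg_one_smul, ← sub_eq_add_neg] at this
    have hcoeff : ∀ m, coeff m (f - g) = coeff m f - ∑ b ∈ S, coeff b f * coeff m (altSum b) :=
      fun m => by rw [coeff_sub, hg, coeff_sum]; simp
    rw [← sub_add_cancel f g]
    refine add_mem (ih _ hsub (fun k => ?_) (fun k => ?_) fun m hm => ?_) hgmem
    · refine dvd_sub (hX k) (dvd_sum fun b hb => ?_)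
      exact (X_dvd_altSum (hpos b hb) k).trans (Dvd.intro_left (C (coeff b f)) (by
        rw [smul_eq_C_mul]))
    · refine (degreeOf_sub_le _ _ _).trans (max_le (hN k) ?_)
      refine (degreeOf_sum_le _ _ _).trans (Finset.sup_le fun b hb => ?_)
      rw [smul_eq_C_mul]
      refine (degreeOf_C_mul_le _ _ _).trans (degreeOf_altSum_le (hSb b hb).1 (fun i => ?_) k)
      exact degreeOf_le_iff.1 (hN i) b (hSb b hb).2.2
    · by_contra hlt
      refine mem_support_iff.1 hm ?_
      have hle : m.degree + r ≤ n * N := by omega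
      rcases hle.lt_or_eq with hlt' | heq
      · rw [hcoeff, notMem_support_iff.1 fun h => by have := hr m h; omega, zero_sub,
          neg_eq_zero]
        refine sum_eq_zero fun b hb => ?_
        rw [coeff_altSum_of_degree_lt (by have := (hSb b hb).2.1; omega), mul_zero]
      -- By antisymmetry only strictly decreasing exponents need checking, and there the subtraction
      -- was arranged to cancel.
      · refine hsub.coeff_eq_zero (fun c hc hcd => ?_) rfl
        have h1 : ∀ b ∈ S, coeff b f * coeff c (altSum b) = if b = c then coeff c f else 0 :=
          fun b hb => by
            rw [coeff_altSum_of_strictAnti (by have := (hSb b hb).2.1; omega) (hSb b hb).1 hc]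
            split_ifs with h
            · rw [h, mul_one]
            · rw [mul_zero]
        rw [hcoeff, sum_congr rfl h1, sum_ite_eq']
        split_ifs with h
        · rw [sub_self]
        · rw [sub_zero]
          by_contra h0
          exact h (mem_filter.2 ⟨mem_support_iff.2 h0, hc, by omega⟩)

/-- In a relation, an exponent b of least degree receives a contribution from `altSum b` alone. -/
lemma linearIndepOn_altSum :
    LinearIndepOn ZBeta (altSum : (Fin n →₀ ℕ) → MvPolynomial (Fin n) ZBeta)
      {b | StrictAnti b} := by
  rw [linearIndepOn_iff]
  intro l hl h0
  by_contra hne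
  obtain ⟨b, hb, hmin⟩ := exists_min_image l.support (fun b => b.degree)
    (Finsupp.support_nonempty_iff.2 hne)
  have hanti : ∀ c ∈ l.support, StrictAnti c := fun c hc => hl hc
  have h1 := congrArg (coeff b) h0
  rw [Finsupp.linearCombination_apply, Finsupp.sum, coeff_sum, coeff_zero,
    sum_eq_single b] at h1
  · rw [coeff_smul, coeff_altSum_of_strictAnti le_rfl (hanti b hb) (hanti b hb), if_pos rfl,
      smul_eq_mul, mul_one] at h1
    exact Finsupp.mem_support_iff.1 hb h1
  · intro c hc hcb
    rw [coeff_smul, coeff_altSum_of_strictAnti (hmin c hc) (hanti c hc) (hanti b hb),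
      if_neg hcb, smul_zero]
  · exact fun h => absurd hb h

end Antisymmetric

/-! ### The basis theorem -/

section TopLength

variable {n : ℕ}

lemma sum_permNumerator_eq {lam : StrictPartition} (h : lam.length = n) :
    vandermondeProd X * GPPoly n lam =
      ∑ w, permNumerator (betaPoly n) X n lam.parts w := by
  apply FaithfulSMul.algebraMap_injective (MvPolynomial (Fin n) ZBeta) (RatField n)
  have hbij : Function.Bijective (restrictPerm (le_refl n)) := by
    refine ⟨fun w w' hw => Equiv.ext fun i => ?_, exists_restrictPerm_eq _⟩
    exact DFunLike.congr_fun hw i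
  subst h
  rw [map_mul, map_vandermondeProd, algebraMap_GPPoly, map_sum, embeddingSum, mul_sum]
  symm
  refine Fintype.sum_bijective _ hbij _ _ fun w => ?_
  rw [map_permNumerator, ← aeval_ratVar, aeval_betaPoly, ← permTerm_eq_embeddingTerm]
  exact permNumerator_eq _ ratVar_injective _ _ _

/-- Multiplied by the Vandermonde product, the factors become antisymmetric in i and j. Both
products then acquire sign(w), which cancels. -/
lemma prod_oplusPoly_comp_perm (w : Equiv.Perm (Fin n)) :
    ∏ i, ∏ j ∈ Ioi i, oplusPoly (w i) (w j) = oplusProd n := by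
  have h1 := w.prod_Ioi_comp_eq_sign_mul_prod
    (f := fun i j => oplusPoly i j * (X i - X j : MvPolynomial (Fin n) ZBeta))
    fun i j => by rw [oplusPoly_comm]; ring
  simp only [prod_mul_distrib] at h1
  have h2 := vandermondeProd_comp_perm (X : Fin n → MvPolynomial (Fin n) ZBeta) w
  have h3 : vandermondeProd ((X : Fin n → MvPolynomial (Fin n) ZBeta) ∘ w) ≠ 0 :=
    vandermondeProd_ne_zero (X_injective.comp w.injective)
  refine mul_right_cancel₀ h3 (Eq.trans h1 ?_)
  rw [h2, mul_left_comm]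
  rfl

lemma prod_prod_Ioi_eq {A : Type*} [CommMonoid A] (g : Fin n → A) :
    ∏ i, ∏ j ∈ Ioi i, g j = ∏ j, g j ^ (j : ℕ) := by
  rw [prod_comm' (t' := univ) (s' := fun j => Iio j) (by simp)]
  simp

/-- The parts of a strict partition as exponents of `x_1, …, x_n`. -/
def StrictPartition.exponent (n : ℕ) (lam : StrictPartition) : Fin n →₀ ℕ :=
  Finsupp.equivFunOnFinite.symm fun i => lam.parts.getD i 0

lemma StrictPartition.exponent_apply (lam : StrictPartition) (i : Fin n) :
    lam.exponent n i = lam.parts.getD i 0 := rfl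

/-- At full length all pairs i < j occur. The product of the x_i ⊕ x_j is symmetric and factors out,
and 1 + βx_{w(j)} appears once for each i < j. -/
lemma vandermondeProd_mul_GPPoly_of_length_eq {lam : StrictPartition} (h : lam.length = n) :
    vandermondeProd X * GPPoly n lam = oplusProd n * altSum (lam.exponent n) := by
  rw [sum_permNumerator_eq h, altSum, mul_sum]
  refine sum_congr rfl fun w _ => ?_
  rw [permNumerator, mul_left_comm]
  congr 1
  rw [prod_congr rfl fun i _ => if_pos i.2]
  simp only [prod_mul_distrib]
  rw [prod_prod_Ioi_eq fun j => 1 + betaPoly n * X (w j), ← prod_oplusPoly_comp_perm w,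
    mul_left_comm]
  rfl

lemma StrictPartition.strictAnti_exponent {lam : StrictPartition} (h : lam.length = n) :
    StrictAnti (lam.exponent n) := by
  intro i j hij
  have hi : (i : ℕ) < lam.parts.length := i.2.trans_eq h.symm
  have hj : (j : ℕ) < lam.parts.length := j.2.trans_eq h.symm
  rw [exponent_apply, exponent_apply, List.getD_eq_getElem _ _ hi, List.getD_eq_getElem _ _ hj]
  exact List.pairwise_iff_getElem.1 lam.strictlyDecreasing _ _ hi hj hij

lemma StrictPartition.exponent_injOn :
    Set.InjOn (StrictPartition.exponent n) {lam | lam.length = n} := by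
  rintro ⟨p, hp, hp'⟩ h ⟨q, hq, hq'⟩ h' hpq
  have hl : p.length = n := h
  have hl' : q.length = n := h'
  have : p = q := by
    refine List.ext_getElem (hl.trans hl'.symm) fun i hi hi' => ?_
    have := DFunLike.congr_fun hpq (⟨i, hi.trans_eq hl⟩ : Fin n)
    rwa [exponent_apply, exponent_apply, List.getD_eq_getElem _ _ hi,
      List.getD_eq_getElem _ _ hi'] at this
  subst this
  rfl

lemma StrictPartition.exists_exponent_eq {b : Fin n →₀ ℕ} (hb : StrictAnti b)
    (hpos : ∀ i, 0 < b i) : ∃ lam : StrictPartition, lam.length = n ∧ lam.exponent n = b := by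
  refine ⟨⟨List.ofFn b, ?_, ?_⟩, List.length_ofFn, ?_⟩
  · rw [List.pairwise_ofFn]
    exact fun i j hij => hb hij
  · intro a ha
    obtain ⟨i, rfl⟩ := (List.mem_ofFn' _ _).1 ha
    exact hpos i
  · ext i
    rw [exponent_apply]
    simp

lemma linearIndepOn_GPPoly_length_eq :
    LinearIndepOn ZBeta (GPPoly n) {lam | lam.length = n} := by
  have h1 : LinearIndepOn ZBeta (fun lam : StrictPartition => altSum (lam.exponent n))
      {lam | lam.length = n} := by
    refine (linearIndepOn_altSum.mono ?_).comp_of_image (f := StrictPartition.exponent n)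
      StrictPartition.exponent_injOn
    rintro _ ⟨lam, h, rfl⟩
    exact StrictPartition.strictAnti_exponent h
  rw [linearIndepOn_iff] at h1 ⊢
  intro l hl h0
  refine h1 l hl (mul_left_cancel₀ (oplusProd_ne_zero n) ?_)
  rw [mul_zero, ← mul_zero (vandermondeProd X), ← h0, Finsupp.linearCombination_apply,
    Finsupp.linearCombination_apply, Finsupp.sum, Finsupp.sum, mul_sum, mul_sum]
  refine sum_congr rfl fun lam hlam => ?_
  rw [mul_smul_comm, mul_smul_comm, vandermondeProd_mul_GPPoly_of_length_eq (hl hlam)]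

/-- Since f vanishes at x_j = 0, the criterion makes every x_i ⊕ x_j divide f. The quotient by their
product, times the Vandermonde product, expands in alternants. -/
lemma mem_span_GPPoly_of_X_dvd {f : MvPolynomial (Fin n) ZBeta} (hf : f ∈ GGamma n)
    (hX : ∀ i, X i ∣ f) :
    f ∈ Submodule.span ZBeta (GPPoly n '' {lam | lam.length = n}) := by
  rw [mem_GGamma_iff] at hf
  obtain ⟨g, rfl⟩ : oplusProd n ∣ f := oplusProd_dvd fun i j hij => by
    have := hf.2 i j hij
    rwa [eraseVar_eq_zero_of_X_dvd (hX j), map_zero, sub_zero] at this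
  have hXg : ∀ i, X i ∣ g := fun i =>
    (X_prime.dvd_or_dvd (hX i)).resolve_left (not_X_dvd_oplusProd i)
  have hsymm : ∀ σ : Equiv.Perm (Fin n), rename σ g = g := fun σ => by
    have h1 := hf.1 σ
    have h2 : rename σ (oplusProd n) = oplusProd n := by
      nth_rw 2 [← prod_oplusPoly_comp_perm σ]
      simp [oplusProd, oplusPoly, betaPoly, map_prod]
    rw [map_mul, h2] at h1
    exact mul_left_cancel₀ (oplusProd_ne_zero n) h1
  have hanti : IsAntisymmetric (vandermondeProd X * g) := fun σ => by
    rw [map_mul, rename_vandermondeProd, hsymm, mul_assoc]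
  have hmem := mem_span_altSum hanti fun k => Dvd.dvd.mul_left (hXg k) _
  have key : ∀ y ∈ Submodule.span ZBeta
      (altSum '' {b : Fin n →₀ ℕ | StrictAnti b ∧ ∀ i, 0 < b i}),
      ∃ z ∈ Submodule.span ZBeta (GPPoly n '' {lam | lam.length = n}),
        vandermondeProd X * z = oplusProd n * y := by
    intro y hy
    induction hy using Submodule.span_induction with
    | mem y hy =>
      obtain ⟨b, ⟨hb, hpos⟩, rfl⟩ := hy
      obtain ⟨lam, hlam, rfl⟩ := StrictPartition.exists_exponent_eq hb hpos
      exact ⟨_, Submodule.subset_span ⟨lam, hlam, rfl⟩,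
        vandermondeProd_mul_GPPoly_of_length_eq hlam⟩
    | zero => exact ⟨0, zero_mem _, by simp⟩
    | add y₁ y₂ _ _ h₁ h₂ =>
      obtain ⟨z₁, hz₁, h₁⟩ := h₁
      obtain ⟨z₂, hz₂, h₂⟩ := h₂
      exact ⟨z₁ + z₂, add_mem hz₁ hz₂, by rw [mul_add, mul_add, h₁, h₂]⟩
    | smul c y _ h =>
      obtain ⟨z, hz, h⟩ := h
      exact ⟨c • z, Submodule.smul_mem _ _ hz, by rw [mul_smul_comm, mul_smul_comm, h]⟩
  obtain ⟨z, hz, h⟩ := key _ hmem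
  rw [mul_left_comm] at h
  rwa [← mul_left_cancel₀ vandermondeProd_X_ne_zero h]

end TopLength

/-! ### Induction on the number of variables and passage to the limit -/

section Basis

lemma linearCombination_GPPoly_succ (n : ℕ) (l : StrictPartition →₀ ZBeta) :
    specializeLast n (Finsupp.linearCombination ZBeta (GPPoly (n + 1)) l) =
      Finsupp.linearCombination ZBeta (GPPoly n) l := by
  rw [Finsupp.linearCombination_apply, Finsupp.linearCombination_apply, Finsupp.sum, Finsupp.sum,
    map_sum]
  exact sum_congr rfl fun lam _ => by rw [map_smul, specializeLast_GPPoly]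

/-- Setting the last variable to 0 kills only the functions of full length. Induction removes the
shorter ones from a relation, and the full-length ones are independent. -/
lemma linearIndepOn_GPPoly (n : ℕ) :
    LinearIndepOn ZBeta (GPPoly n) {lam | lam.length ≤ n} := by
  induction n with
  | zero =>
    refine linearIndepOn_GPPoly_length_eq.mono fun lam h => ?_
    exact Nat.le_zero.1 h
  | succ n ih =>
    classical
    rw [linearIndepOn_iff] at ih ⊢
    intro l hl h0
    have h1 : l.filter (fun lam => lam.length ≤ n) = 0 := by
      refine ih _ (fun lam hlam => ?_) ?_
      · rw [Finsupp.support_filter] at hlam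
        exact (mem_filter.1 hlam).2
      · have h2 := linearCombination_GPPoly_succ n l
        rw [h0, map_zero, ← Finsupp.filter_add_filter_not l (fun lam => lam.length ≤ n),
          map_add] at h2
        rw [h2, left_eq_add, Finsupp.linearCombination_apply]
        refine sum_eq_zero fun lam hlam => ?_
        rw [Finsupp.support_filter] at hlam
        change _ • GPPoly n lam = 0
        rw [GPPoly_eq_zero (not_le.1 (mem_filter.1 hlam).2), smul_zero]
    refine linearIndepOn_iff.1 linearIndepOn_GPPoly_length_eq l (fun lam hlam => ?_) h0
    refine le_antisymm (hl hlam) (Nat.succ_le_of_lt (not_le.1 fun hle => ?_))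
    have h2 := DFunLike.congr_fun h1 lam
    rw [Finsupp.filter_apply_pos (fun mu : StrictPartition => mu.length ≤ n) _ hle] at h2
    exact Finsupp.mem_support_iff.1 hlam h2

lemma mem_span_GPPoly {n : ℕ} {f : MvPolynomial (Fin n) ZBeta} (hf : f ∈ GGamma n) :
    f ∈ Submodule.span ZBeta (GPPoly n '' {lam | lam.length ≤ n}) := by
  induction n with
  | zero =>
    refine Submodule.span_mono (Set.image_mono fun lam h => ?_)
      (mem_span_GPPoly_of_X_dvd hf fun i => i.elim0)
    exact le_of_eq h
  | succ n ih =>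
    obtain ⟨l, hl, h⟩ := (Finsupp.mem_span_image_iff_linearCombination _).1
      (ih (specializeLast_mem_GGamma hf))
    set g := Finsupp.linearCombination ZBeta (GPPoly (n + 1)) l with hg
    have hgG : g ∈ GGamma (n + 1) := by
      rw [hg, Finsupp.linearCombination_apply]
      exact sum_mem fun lam _ => Subalgebra.smul_mem _ (GPPoly_mem_GGamma lam) _
    -- Here g lifts the expansion of the specialized f, so the difference lies in the kernel.
    have hsub : f - g ∈ GGamma (n + 1) := sub_mem hf hgG
    have hX : X (Fin.last n) ∣ f - g := X_last_dvd_of_specializeLast_eq_zero (by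
      rw [map_sub, hg, linearCombination_GPPoly_succ, h, sub_self])
    rw [← sub_add_cancel f g]
    refine add_mem ?_ ?_
    · refine Submodule.span_mono (Set.image_mono fun lam h => ?_)
        (mem_span_GPPoly_of_X_dvd hsub fun i => X_dvd_of_isSymmetric hsub.1 hX)
      exact le_of_eq h
    · refine (Finsupp.mem_span_image_iff_linearCombination _).2 ⟨l, fun lam hlam => ?_, rfl⟩
      exact Nat.le_succ_of_le (hl hlam)

/-- The functions `GP_lam(x_1, …, x_n)` as a basis of `GΓ_n`. -/
def GPBasis (n : ℕ) : Module.Basis (SP n) ZBeta (GGamma n) :=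
  Module.Basis.mk (v := fun lam : SP n => ⟨GPPoly n lam.1, GPPoly_mem_GGamma lam.1⟩)
    (LinearIndependent.of_comp (GGamma n).val.toLinearMap (linearIndepOn_GPPoly n)) (by
      rintro ⟨f, hf⟩ -
      have h := mem_span_GPPoly hf
      have himage : GPPoly n '' {lam | lam.length ≤ n} = (GGamma n).val.toLinearMap ''
          Set.range fun lam : SP n => (⟨GPPoly n lam.1, GPPoly_mem_GGamma lam.1⟩ : GGamma n) := by
        ext g
        simp only [Set.mem_image, Set.mem_range, exists_exists_eq_and]
        exact ⟨fun ⟨lam, h, hg⟩ => ⟨⟨lam, h⟩, hg⟩, fun ⟨lam, hg⟩ => ⟨lam.1, lam.2, hg⟩⟩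
      rw [himage, ← Submodule.map_span] at h
      obtain ⟨y, hy, hyf⟩ := h
      rwa [← show y = ⟨f, hf⟩ from Subtype.ext hyf])

lemma GPBasis_apply (n : ℕ) (lam : SP n) :
    (GPBasis n lam : MvPolynomial (Fin n) ZBeta) = GPPoly n lam.1 := by
  rw [GPBasis, Module.Basis.mk_apply]

/-- The element `GP_lam(x)` of `GΓ`. -/
def GPLim (lam : StrictPartition) : GGammaLim :=
  ⟨fun n => GPPoly n lam, fun _ => GPPoly_mem_GGamma lam, fun _ => specializeLast_GPPoly lam⟩

lemma exists_linearCombination_GPPoly (f : GGammaLim) (n : ℕ) :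
    ∃ l : StrictPartition →₀ ZBeta, (∀ lam ∈ l.support, lam.length ≤ n) ∧
      Finsupp.linearCombination ZBeta (GPPoly n) l = f.1 n := by
  obtain ⟨l, hl, h⟩ := (Finsupp.mem_span_image_iff_linearCombination _).1
    (mem_span_GPPoly (f.2.1 n))
  exact ⟨l, fun lam hlam => hl hlam, h⟩

lemma eq_of_linearCombination_GPPoly_eq {n : ℕ} {l l' : StrictPartition →₀ ZBeta}
    (hl : ∀ lam ∈ l.support, lam.length ≤ n) (hl' : ∀ lam ∈ l'.support, lam.length ≤ n)
    (h : Finsupp.linearCombination ZBeta (GPPoly n) l =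
      Finsupp.linearCombination ZBeta (GPPoly n) l') : l = l' :=
  linearIndepOn_iffₛ.1 (linearIndepOn_GPPoly n) l hl l' hl' h

lemma linearCombination_filter_GPPoly (n : ℕ) (l : StrictPartition →₀ ZBeta) :
    Finsupp.linearCombination ZBeta (GPPoly n) (l.filter fun lam => lam.length ≤ n) =
      Finsupp.linearCombination ZBeta (GPPoly n) l := by
  classical
  nth_rw 2 [← Finsupp.filter_add_filter_not l (fun lam => lam.length ≤ n)]
  rw [map_add, left_eq_add, Finsupp.linearCombination_apply]
  refine sum_eq_zero fun lam hlam => ?_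
  rw [Finsupp.support_filter] at hlam
  change _ • GPPoly n lam = 0
  rw [GPPoly_eq_zero (not_le.1 (mem_filter.1 hlam).2), smul_zero]

/-- Compatibility of the components makes the coefficient of λ independent of n ≥ r, so it can be
read off at n = r. -/
lemma existsUnique_isInfiniteCombination (f : GGammaLim) :
    ∃! c : StrictPartition → ZBeta, IsInfiniteCombination GPLim c f := by
  classical
  choose l hl hlf using exists_linearCombination_GPPoly f
  have hsucc : ∀ n, (l (n + 1)).filter (fun lam => lam.length ≤ n) = l n := fun n => by
    refine eq_of_linearCombination_GPPoly_eq (n := n) (fun lam hlam => ?_) (hl n) ?_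
    · rw [Finsupp.support_filter] at hlam
      exact (mem_filter.1 hlam).2
    · rw [linearCombination_filter_GPPoly, ← linearCombination_GPPoly_succ, hlf, hlf, f.2.2]
  have hstab : ∀ (lam : StrictPartition) (k : ℕ),
      l (lam.length + k) lam = l lam.length lam := by
    intro lam k
    induction k with
    | zero => rfl
    | succ k ih =>
      rw [← ih, ← hsucc (lam.length + k), Finsupp.filter_apply_pos
        (fun mu : StrictPartition => mu.length ≤ lam.length + k) _ (Nat.le_add_right _ _)]
      rfl
  have hc : ∀ (n : ℕ) (lam : StrictPartition), lam.length ≤ n → l lam.length lam = l n lam :=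
    fun n lam h => by
      obtain ⟨k, rfl⟩ := Nat.exists_eq_add_of_le h
      exact (hstab lam k).symm
  refine ⟨fun lam => l lam.length lam, ?_, ?_⟩
  · have hset : ∀ n, {lam : StrictPartition | lam.length ≤ n ∧ l lam.length lam ≠ 0} =
        (l n).support := fun n => by
      ext lam
      refine ⟨fun ⟨h1, h2⟩ => ?_, fun h => ?_⟩
      · rw [hc n lam h1] at h2
        exact Finsupp.mem_support_iff.2 h2
      · have h1 := hl n lam h
        refine ⟨h1, ?_⟩
        rw [hc n lam h1]
        exact Finsupp.mem_support_iff.1 h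
    refine ⟨fun n => by rw [hset n]; exact (l n).support.finite_toSet, fun n => ?_⟩
    rw [← hlf n, Finsupp.linearCombination_apply, Finsupp.sum]
    refine sum_congr ?_ fun lam hlam => ?_
    · ext lam
      rw [Set.Finite.mem_toFinset, hset n, mem_coe]
    · rw [← hc n lam ((Set.Finite.mem_toFinset _).1 hlam).1]
      rfl
  · rintro c ⟨hfin, hsum⟩
    funext lam
    set n := lam.length with hn
    -- A competing family, cut off at length n, is a finite expansion of the same component, so it
    -- agrees with `l n`.
    have h : l n = Finsupp.onFinset (hfin n).toFinset
        (fun mu => if mu.length ≤ n then c mu else 0) (fun mu hmu => by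
          rw [Set.Finite.mem_toFinset]
          by_cases h : mu.length ≤ n
          · exact ⟨h, by simpa [h] using hmu⟩
          · simp [h] at hmu) := by
      refine eq_of_linearCombination_GPPoly_eq (n := n) (hl n) (fun mu hmu => ?_) ?_
      · have := Finsupp.mem_support_iff.1 hmu
        by_contra h
        exact this (by rw [Finsupp.onFinset_apply, if_neg h])
      · rw [hlf, hsum, Finsupp.linearCombination_apply, Finsupp.onFinset_sum _ (by simp)]
        refine sum_congr rfl fun mu hmu => ?_
        rw [if_pos ((hfin n).mem_toFinset.1 hmu).1]
        rfl
    rw [h, Finsupp.onFinset_apply, if_pos le_rfl]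

end Basis

end

theorem mainTheorem3 :
    (∀ n : ℕ, ∃ B : Module.Basis (SP n) ZBeta (GGamma n),
      ∀ lam : SP n,
        algebraMap (MvPolynomial (Fin n) ZBeta) (RatField n)
          (B lam : MvPolynomial (Fin n) ZBeta) = GP n lam.1) ∧
    (∃ G : StrictPartition → GGammaLim,
      (∀ (lam : StrictPartition) (n : ℕ),
        algebraMap (MvPolynomial (Fin n) ZBeta) (RatField n) ((G lam).1 n) =
          if lam.length ≤ n then GP n lam else 0) ∧
      ∀ f : GGammaLim, ∃! c : StrictPartition → ZBeta, IsInfiniteCombination G c f) := by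
  refine ⟨fun n => ⟨GPBasis n, fun lam => ?_⟩, GPLim, fun lam n => ?_,
    existsUnique_isInfiniteCombination⟩
  · rw [GPBasis_apply, algebraMap_GPPoly_eq_GP lam.2]
  · split_ifs with h
    · exact algebraMap_GPPoly_eq_GP h
    · change algebraMap _ _ (GPPoly n lam) = 0
      rw [GPPoly_eq_zero (not_le.1 h), map_zero]
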